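/- Let $R$ be a crystallographic, possibly nonreduced, root system spanning a finite-dimensional real Euclidean space $(E,\langle\cdot,\cdot\rangle)$, with Weyl group $W$ (generated by the orthogonal reflections $r_\alpha$), coroots $\alpha^\vee=2\alpha/\langle\alpha,\alpha\rangle$ spanning the lattice $\mathcal Q^\vee$ over $\mathbb Z$, and a choice $R^+$ of positive roots. Let $\mathcal P^+=\{\lambda\in E:\langle\lambda,\alpha^\vee\rangle\in\mathbb N\ \forall\alpha\in R^+\}$, partially ordered by $\mu\preceq\lambda\iff\lambda-\mu\in\mathrm{Span}_{\mathbb N}(R^+)$. Let $g_\alpha\ge 0$ $(\alpha\in R)$ be parameters with $g_{w(\alpha)}=g_\alpha$ for all $w\in W$. Put $e^\mu(x)=e^{i\langle\mu,x\rangle}$ and $m_\mu=\sum_{\nu\in W(\mu)}e^\nu$, and for Fourier polynomials $f,h$ on the torus $\mathbb T=E/2\pi\mathcal Q^\vee$ put $$\langle f,h\rangle_\Delta=\frac1{|W|}\int_{\mathbb T}f\,\overline h\,\Delta\,dx,\qquad \Delta=\prod_{\alpha\in R}(1-e^\alpha)^{g_\alpha}=\prod_{\alpha\in R}|1-e^\alpha|^{g_\alpha}.$$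 For $\lambda\in\mathcal P^+$ the monic Heckman--Opdam polynomial is the function of the form $p_\lambda=m_\lambda+\sum_{\mu\in\mathcal P^+,\,\mu\prec\lambda}c_{\lambda\mu}m_\mu$ such that $\langle p_\lambda,m_\mu\rangle_\Delta=0$ for all $\mu\in\mathcal P^+$ with $\mu\prec\lambda$. Let $\rho_g=\frac12\sum_{\alpha\in R^+}g_\alpha\alpha$ and, for $\mu,\nu\in\mathcal P^+$, let $$\epsilon_\mu=\langle\mu+\rho_g,\mu+\rho_g\rangle-\langle\rho_g,\rho_g\rangle,\qquad d_{\mu\nu}=\frac{|W_\nu|}{|W_\mu|}\sum_{\alpha\in[\mu,\nu]}g_\alpha\langle\mu,\alpha\rangle\,n_{\mu\nu}(\alpha),$$ where $W_\mu$ is the stabilizer of $\mu$ in $W$, $[\mu,\nu]$ is the set of $\alpha\in R^+$ such that $\mu-\ell\alpha\in W(\nu)$ for some integer $\ell$ with $1\le\ell\le\lfloor\langle\mu,\alpha^\vee\rangle/2\rfloor$, and $n_{\mu\nu}(\alpha)=1$ if $\|\nu\|=\|\frac12(\mu+r_\alpha\mu)\|$ and $n_{\mu\nu}(\alpha)=2$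 otherwise. **Theorem.** Let $\lambda\in\mathcal P^+$. Then $p_\lambda$ exists and is unique. Moreover, let $\lambda^{(1)},\dots,\lambda^{(n)}=\lambda$ be any enumeration without repetition of $\{\mu\in\mathcal P^+:\mu\preceq\lambda\}$ that refines the partial order ($\lambda^{(j)}\preceq\lambda^{(k)}$ implies $j\le k$). Then the following hold. (i) $p_\lambda=\mathcal E_\lambda^{-1}\det H$, where $\mathcal E_\lambda=\prod_{\mu\in\mathcal P^+,\,\mu\prec\lambda}(\epsilon_\lambda-\epsilon_\mu)$ and $H$ is the $n\times n$ lower Hessenberg matrix whose $j$-th row has first entry $m_{\lambda^{(j)}}$ and whose entry in column $k+1$ $(1\le k\le n-1)$ is $d_{\lambda^{(j)}\lambda^{(k)}}$ if $k<j$, $\epsilon_{\lambda^{(j)}}-\epsilon_{\lambda^{(n)}}$ if $k=j$, and $0$ if $k>j$. (ii) The coefficients of $p_\lambda=\sum_{\ell=1}^n c_{\lambda\lambda^{(\ell)}}m_{\lambda^{(\ell)}}$ satisfy $c_{\lambda\lambda^{(n)}}=1$ and $$c_{\lambda\lambda^{(\ell-1)}}=\frac{1}{\epsilon_\lambda-\epsilon_{\lambda^{(\ell-1)}}}\sum_{k=\ell}^n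 c_{\lambda\lambda^{(k)}}\,d_{\lambda^{(k)}\lambda^{(\ell-1)}}\qquad(1<\ell\le n).$$ (iii) For $1\le\ell<n$, $$c_{\lambda\lambda^{(\ell)}}=\sum_{r=1}^{n-\ell}\ \sum_{\ell=j_r<j_{r-1}<\cdots<j_1<j_0=n}\frac{d_{\lambda^{(j_0)}\lambda^{(j_1)}}d_{\lambda^{(j_1)}\lambda^{(j_2)}}\cdots d_{\lambda^{(j_{r-1})}\lambda^{(j_r)}}}{(\epsilon_\lambda-\epsilon_{\lambda^{(j_1)}})\cdots(\epsilon_\lambda-\epsilon_{\lambda^{(j_r)}})},$$ and $c_{\lambda\lambda^{(n)}}=1$. -/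

import Mathlib

open scoped ComplexConjugate InnerProductSpace

noncomputable section

/-- A root pairing in a Euclidean space `E` is Euclidean if its coroots are the usual vectors
`α^∨ = 2α / ⟨α, α⟩`, viewed as functionals through the inner product; equivalently,
the reflections of the root pairing are the orthogonal reflections of `E`. -/
class RootPairing.IsEuclidean {ι E N : Type*} [NormedAddCommGroup E] [InnerProductSpace ℝ E]
    [AddCommGroup N] [Module ℝ N] (P : RootPairing ι ℝ E N) : Prop where
  coroot'_eq : ∀ (i : ι) (x : E),
    P.coroot' i x = 2 * ⟪x, P.root i⟫_ℝ / ⟪P.root i, P.root i⟫_ℝ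

namespace HeckmanOpdam

variable {ι : Type*} {E : Type*} [NormedAddCommGroup E] [InnerProductSpace ℝ E]
  {N : Type*} [AddCommGroup N] [Module ℝ N] (P : RootPairing ι ℝ E N)

/-! ### Positive roots, dominant weights, and the natural partial order -/

/-- `Φ` is (the set of indices of) a system `R⁺` of positive roots: the roots that are positive
on some vector lying on no root hyperplane. -/
def IsPositiveSystem (Φ : Finset ι) : Prop :=
  ∃ γ : E, (∀ i, ⟪γ, P.root i⟫_ℝ ≠ 0) ∧ ∀ i, i ∈ Φ ↔ 0 < ⟪γ, P.root i⟫_ℝ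

/-- The cone `𝒫⁺` of dominant weights: `⟨μ, α^∨⟩ ∈ ℕ` for all positive roots `α`. -/
def IsDominant (Φ : Finset ι) (μ : E) : Prop :=
  ∀ i ∈ Φ, ∃ k : ℕ, P.coroot' i μ = k

/-- The natural partial order: `Preceq P Φ μ lam` means that `lam - μ` is a sum of
positive roots. -/
def Preceq (Φ : Finset ι) (μ lam : E) : Prop :=
  lam - μ ∈ AddSubmonoid.closure (P.root '' (Φ : Set ι))

/-- The set of the dominant weights `μ` with `μ ⪯ lam`. -/
def dominantBelow (Φ : Finset ι) (lam : E) : Set E :=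
  {μ | IsDominant P Φ μ ∧ Preceq P Φ μ lam}

/-- `e 0, …, e n` is a linear ordering of the dominant weights `μ ⪯ lam`, with last term `lam`,
that refines the natural order. -/
structure IsLinearOrdering (Φ : Finset ι) (lam : E) {n : ℕ} (e : Fin (n + 1) → E) : Prop where
  injective : Function.Injective e
  range_eq : Set.range e = dominantBelow P Φ lam
  refines : ∀ j k, Preceq P Φ (e j) (e k) → j ≤ k
  last_eq : e (Fin.last n) = lam

/-! ### The torus and the invariant Fourier polynomials on it -/

/-- The lattice `2π 𝒬^∨`, spanned over `ℤ` by the vectors `2π α^∨` with `α^∨ = 2α / ⟨α, α⟩`. -/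
def torusLattice : Submodule ℤ E :=
  Submodule.span ℤ
    (Set.range fun i => (2 * Real.pi) • (2 / ⟪P.root i, P.root i⟫_ℝ) • P.root i)

theorem exists_int_of_mem_torusLattice [P.IsCrystallographic] [P.IsEuclidean] {x : E}
    (hx : x ∈ torusLattice P) (i : ι) : ∃ k : ℤ, ⟪P.root i, x⟫_ℝ = k * (2 * Real.pi) := by
  induction hx using Submodule.span_induction with
  | mem y hy =>
    obtain ⟨j, rfl⟩ := hy
    obtain ⟨k, hk⟩ := P.exists_value (S := ℤ) i j
    refine ⟨k, ?_⟩
    have h : P.pairing i j = 2 * ⟪P.root i, P.root j⟫_ℝ / ⟪P.root j, P.root j⟫_ℝ :=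
      RootPairing.IsEuclidean.coroot'_eq (P := P) j (P.root i)
    have hk' : (k : ℝ) = P.pairing i j := by simpa using hk
    simp only [inner_smul_right]
    rw [hk', h]
    ring
  | zero => exact ⟨0, by simp⟩
  | add y z _ _ hy hz =>
    obtain ⟨k, hk⟩ := hy
    obtain ⟨l, hl⟩ := hz
    exact ⟨k + l, by rw [inner_add_right, hk, hl]; push_cast; ring⟩
  | smul a y _ hy =>
    obtain ⟨k, hk⟩ := hy
    refine ⟨a * k, ?_⟩
    rw [← Int.cast_smul_eq_zsmul ℝ a y, inner_smul_right, hk]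
    push_cast
    ring

theorem eq_zero_of_inner_root_eq_zero [P.IsRootSystem] {x : E}
    (hx : ∀ i, ⟪P.root i, x⟫_ℝ = 0) : x = 0 := by
  have h : ∀ y ∈ Submodule.span ℝ (Set.range P.root), ⟪y, x⟫_ℝ = 0 := by
    intro y hy
    induction hy using Submodule.span_induction with
    | mem y hy => obtain ⟨i, rfl⟩ := hy; exact hx i
    | zero => simp
    | add y z _ _ hy hz => rw [inner_add_left, hy, hz, add_zero]
    | smul a y _ hy => rw [inner_smul_left, hy, mul_zero]
  have hx' : x ∈ Submodule.span ℝ (Set.range P.root) := by simp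
  exact inner_self_eq_zero.mp (h x hx')

instance [Finite ι] [P.IsRootSystem] [P.IsCrystallographic] [P.IsEuclidean] :
    DiscreteTopology (torusLattice P) := by
  refine discreteTopology_of_isOpen_singleton_zero ?_
  have hset : ({0} : Set (torusLattice P)) =
      ⋂ i, {x : torusLattice P | |⟪P.root i, (x : E)⟫_ℝ| < 2 * Real.pi} := by
    ext x
    simp only [Set.mem_singleton_iff, Set.mem_iInter, Set.mem_ofPred_eq]
    constructor
    · rintro rfl i
      simpa using Real.pi_pos
    · intro h
      refine Subtype.ext (eq_zero_of_inner_root_eq_zero P fun i => ?_)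
      obtain ⟨k, hk⟩ := exists_int_of_mem_torusLattice P x.2 i
      have hi := h i
      have hpi : 0 < 2 * Real.pi := by positivity
      rw [hk, abs_mul, abs_of_pos hpi, mul_lt_iff_lt_one_left hpi] at hi
      have hk0 : k = 0 := by
        rw [← Int.abs_lt_one_iff]
        exact_mod_cast hi
      simp [hk, hk0]
  rw [hset]
  refine isOpen_iInter_of_finite fun i => ?_
  exact isOpen_lt (by fun_prop) continuous_const

instance [Finite ι] [P.IsRootSystem] [P.IsCrystallographic] [P.IsEuclidean] :
    IsZLattice ℝ (torusLattice P) where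
  span_top := by
    rw [eq_top_iff, ← RootPairing.IsRootSystem.span_root_eq_top (P := P), Submodule.span_le]
    rintro _ ⟨i, rfl⟩
    have hne : ⟪P.root i, P.root i⟫_ℝ ≠ 0 := inner_self_ne_zero.mpr (P.ne_zero i)
    have hmem : (2 * Real.pi) • (2 / ⟪P.root i, P.root i⟫_ℝ) • P.root i ∈
        Submodule.span ℝ (torusLattice P : Set E) :=
      Submodule.subset_span (Submodule.subset_span ⟨i, rfl⟩)
    have h := Submodule.smul_mem _ (⟪P.root i, P.root i⟫_ℝ / (2 * (2 * Real.pi))) hmem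
    rw [smul_smul (2 * Real.pi), smul_smul] at h
    have hone : ⟪P.root i, P.root i⟫_ℝ / (2 * (2 * Real.pi)) *
        (2 * Real.pi * (2 / ⟪P.root i, P.root i⟫_ℝ)) = 1 := by
      have := Real.pi_ne_zero
      field_simp
    rwa [hone, one_smul] at h

/-- The exponential `e^μ`, realized as the function `x ↦ e^{i ⟨μ, x⟩}`. -/
def expo (μ x : E) : ℂ :=
  Complex.exp (Complex.I * (⟪μ, x⟫_ℝ : ℂ))

/-- The monomial symmetric function `m_μ`, the sum of `e^ν` over the Weyl orbit of `μ`. -/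
def monomial (μ x : E) : ℂ :=
  ∑ᶠ ν ∈ MulAction.orbit P.weylGroup μ, expo ν x

/-- The weight function `∏_{α ∈ R} (1 - e^α)^{g_α}`. As `e^{-α}` is the complex conjugate of `e^α`
and `g_{-α} = g_α`, it is the product of the `|1 - e^α|^{g_α}`. -/
def weight [Fintype ι] (g : ι → ℝ) (x : E) : ℝ :=
  ∏ i, ‖1 - expo (P.root i) x‖ ^ g i

/-- The combination `∑ c_μ m_μ` over the dominant weights `μ ⪯ lam`. -/
def expansion (Φ : Finset ι) (lam : E) (c : E → ℂ) : E → ℂ :=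
  fun x => ∑ᶠ μ ∈ dominantBelow P Φ lam, c μ * monomial P μ x

section Torus

variable [Fintype ι] [FiniteDimensional ℝ E] [P.IsRootSystem] [P.IsCrystallographic] [P.IsEuclidean]

/-- A fundamental parallelepiped for the translation action of `2π 𝒬^∨` on `E`. Integrals of
`2π 𝒬^∨`-periodic functions over it are integrals over the torus `𝕋 = E / 2π 𝒬^∨`
and do not depend on the choice of the basis. -/
def torusDomain : Set E :=
  ZSpan.fundamentalDomain
    ((Module.Free.chooseBasis ℤ (torusLattice P)).ofZLatticeBasis ℝ (torusLattice P))

/-- The inner product `|W|⁻¹ ∫_𝕋 f ḡ Δ dx`. -/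
def torusInner [MeasurableSpace E] [BorelSpace E] (g : ι → ℝ) (f h : E → ℂ) : ℂ :=
  (1 / (Nat.card P.weylGroup : ℂ)) *
    ∫ x in torusDomain P, f x * conj (h x) * (weight P g x : ℂ)

/-- `p` is the monic Heckman–Opdam polynomial `p_lam` with parameters `g`: it is of the form
`m_lam + ∑ c_μ m_μ`, summed over the dominant `μ ≺ lam`, and orthogonal to all these `m_μ`. -/
def IsHeckmanOpdam [MeasurableSpace E] [BorelSpace E] (Φ : Finset ι) (g : ι → ℝ) (lam : E)
    (p : E → ℂ) : Prop :=
  (∃ c : E → ℂ, c lam = 1 ∧ p = expansion P Φ lam c) ∧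
    ∀ μ ∈ dominantBelow P Φ lam, μ ≠ lam → torusInner P g p (monomial P μ) = 0

end Torus

/-! ### The matrix elements -/

/-- The weighted half-sum `ρ_g` of the positive roots. -/
def rho (Φ : Finset ι) (g : ι → ℝ) : E :=
  (1 / 2 : ℝ) • ∑ i ∈ Φ, g i • P.root i

/-- `ε_μ = ⟨μ + ρ_g, μ + ρ_g⟩ - ⟨ρ_g, ρ_g⟩`. -/
def eps (Φ : Finset ι) (g : ι → ℝ) (μ : E) : ℝ :=
  ⟪μ + rho P Φ g, μ + rho P Φ g⟫_ℝ - ⟪rho P Φ g, rho P Φ g⟫_ℝ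

/-- The order `|W_μ|` of the stabilizer of `μ` in the Weyl group. -/
def stabOrder (μ : E) : ℕ :=
  Nat.card (MulAction.stabilizer P.weylGroup μ)

open Classical in
/-- The set `[μ, ν]` of the positive roots `α` such that `μ - ℓ α` lies in the Weyl orbit of `ν`
for some `ℓ ∈ {1, …, ⌊⟨μ, α^∨⟩ / 2⌋}`. -/
def rootString (Φ : Finset ι) (μ ν : E) : Finset ι :=
  {i ∈ Φ | ∃ l : ℕ, 1 ≤ l ∧ l ≤ ⌊P.coroot' i μ / 2⌋₊ ∧
    μ - l • P.root i ∈ MulAction.orbit P.weylGroup ν}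

open Classical in
/-- `n_{μν}(α)` is `1` if `‖ν‖ = ‖P_α μ‖` and `2` otherwise, where `P_α = (Id + r_α) / 2`. -/
def mult (μ ν : E) (i : ι) : ℝ :=
  if ‖ν‖ = ‖(1 / 2 : ℝ) • (μ + P.reflection i μ)‖ then 1 else 2

/-- `d_{μν} = |W_ν| / |W_μ| ∑_{α ∈ [μ, ν]} g_α ⟨μ, α⟩ n_{μν}(α)`. -/
def dcoef (Φ : Finset ι) (g : ι → ℝ) (μ ν : E) : ℝ :=
  (stabOrder P ν : ℝ) / (stabOrder P μ : ℝ) *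
    ∑ i ∈ rootString P Φ μ ν, g i * ⟪μ, P.root i⟫_ℝ * mult P μ ν i

/-- `ℰ_lam`, the product of `ε_lam - ε_μ` over the dominant weights `μ ≺ lam`. -/
def normalization (Φ : Finset ι) (g : ι → ℝ) (lam : E) : ℝ :=
  ∏ᶠ μ ∈ dominantBelow P Φ lam \ {lam}, (eps P Φ g lam - eps P Φ g μ)

/-- The lower Hessenberg matrix, at the point `x`: row `j` has first entry `m_{e j}(x)`, and its
entry in column `k + 1` is `d_{e j, e k}` below the superdiagonal (`k < j`), `ε_{e j} - ε_{e n}`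
on the superdiagonal (`k = j`), and `0` above it. -/
def hessenberg (Φ : Finset ι) (g : ι → ℝ) {n : ℕ} (e : Fin (n + 1) → E) (x : E) :
    Matrix (Fin (n + 1)) (Fin (n + 1)) ℂ :=
  Matrix.of fun j => Fin.cons (monomial P (e j) x) fun k : Fin n =>
    if k.castSucc < j then (dcoef P Φ g (e j) (e k.castSucc) : ℂ)
    else if k.castSucc = j then ((eps P Φ g (e j) - eps P Φ g (e (Fin.last n)) : ℝ) : ℂ)
    else 0

open Classical in
/-- The sum over `r = 1, …, n - l` and over the chains `l = j_r < ⋯ < j_1 < j_0 = n` of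
`d_{e j_0, e j_1} ⋯ d_{e j_{r-1}, e j_r} / ((ε_lam - ε_{e j_1}) ⋯ (ε_lam - ε_{e j_r}))`. -/
def chainSum (Φ : Finset ι) (g : ι → ℝ) (lam : E) {n : ℕ} (e : Fin (n + 1) → E)
    (l : Fin (n + 1)) : ℝ :=
  ∑ r ∈ Finset.Icc 1 (n - (l : ℕ)),
    ∑ j : Fin (r + 1) → Fin (n + 1) with
        StrictAnti j ∧ j 0 = Fin.last n ∧ j (Fin.last r) = l,
      (∏ k : Fin r, dcoef P Φ g (e (j k.castSucc)) (e (j k.succ))) /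
        ∏ k : Fin r, (eps P Φ g lam - eps P Φ g (e (j k.succ)))

end HeckmanOpdam

end

open HeckmanOpdam

open scoped ComplexConjugate InnerProductSpace

/-! Put M_μ = ∑_{w ∈ W} e^{wμ} = |W_μ| m_μ, and let D be the Heckman–Opdam Laplacian, with sign
chosen so that D M_μ = ⟨μ, μ⟩ M_μ + ½ ∑_{α ∈ R} g_α (1 + e^{-α})/(1 - e^{-α}) ∂_α M_μ, where ∂_α e^ν
= ⟨ν, α⟩ e^ν. Two properties of D carry the theorem.

D is triangular: D m_μ = ε_μ m_μ + ∑_{ν ≺ μ} d_{μν} m_ν (`hypergeometricOp_eq`). Summing geometric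
series turns the quotient into the strings μ - lα, 0 ≤ l ≤ k = ⟨μ, α^∨⟩. The end points give the
linear part of ε_μ. An orbit that meets the interior of a string does so only in l and k - l, for
reasons of norm, whence n_{μν}(α). That the dominant weights ν so obtained precede μ, and that an
orbit has only one of them, rests on `exists_descends`.

D is symmetric for the inner product with weight Δ (`integral_hypergeometricOp_symm`), by
integration by parts. Since Δ need not be differentiable on the walls, |1 - e^α|² is replaced by |1
- e^α|² + δ, and δ tends to 0.

The Gram matrix of the m_μ is definite, so p_λ exists and is unique. D p_λ - ε_λ p_λ lies in the
span of the lower m_μ and is orthogonal to that span, hence vanishes. Comparing coefficients gives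
(ε_λ - ε_ν) c_ν = ∑_μ c_μ d_{μν}, summed over the later μ (`IsHeckmanOpdam.sub_mul_coeff`). Because
ε_ν < ε_λ for ν ≺ λ (`eps_lt_eps`), this is the recurrence. Iterating it gives the sums over chains
(`eq_sum_chainWeight`); read as a linear relation between the rows of the Hessenberg matrix, it
gives the determinant (`det_hessenberg`). -/

namespace HeckmanOpdam

/-! ### The Weyl group: finiteness, isometric action, integral weights -/

section WeylGroup

variable {ι : Type*} {E : Type*} [NormedAddCommGroup E] [InnerProductSpace ℝ E]
  {N : Type*} [AddCommGroup N] [Module ℝ N] (P : RootPairing ι ℝ E N)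

theorem inner_root_self_pos (i : ι) : 0 < ⟪P.root i, P.root i⟫_ℝ :=
  real_inner_self_pos.mpr (P.ne_zero i)

theorem smul_real_smul (w : P.weylGroup) (a : ℝ) (x : E) : w • (a • x) = a • w • x :=
  smul_comm (w : P.Aut) a x

theorem smul_nsmul_eq (w : P.weylGroup) (a : ℕ) (x : E) : w • (a • x) = a • w • x := by
  rw [← Nat.cast_smul_eq_nsmul ℝ, smul_real_smul, Nat.cast_smul_eq_nsmul]

theorem weylGroupToPerm_mul_apply (v w : P.weylGroup) (i : ι) :
    P.weylGroupToPerm (v * w) i = P.weylGroupToPerm v (P.weylGroupToPerm w i) := by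
  rw [map_mul]; rfl

theorem exists_root_eq_neg (i : ι) : ∃ j, P.root j = -P.root i :=
  ⟨P.reflectionPerm i i, by simp⟩

/-- The roots span E, so an element of W is determined by its permutation of the finitely many
roots. -/
instance finite_weylGroup [Finite ι] [P.IsRootSystem] : Finite P.weylGroup := by
  refine Finite.of_injective (fun w : P.weylGroup => P.weylGroupToPerm w) fun v w h => ?_
  refine Subtype.ext (RootPairing.Equiv.weightHom_injective P (LinearEquiv.ext fun x => ?_))
  have hx : x ∈ Submodule.span ℝ (Set.range P.root) := by simp
  change v • x = w • x
  induction hx using Submodule.span_induction with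
  | mem y hy =>
    obtain ⟨i, rfl⟩ := hy
    rw [P.weylGroup_apply_root, P.weylGroup_apply_root, show P.weylGroupToPerm v = _ from h]
  | zero => simp
  | add y z _ _ hy hz => rw [smul_add, smul_add, hy, hz]
  | smul a y _ hy => rw [smul_real_smul, smul_real_smul, hy]

variable [P.IsEuclidean]

theorem coroot'_mul_inner (i : ι) (x : E) :
    P.coroot' i x * ⟪P.root i, P.root i⟫_ℝ = 2 * ⟪x, P.root i⟫_ℝ := by
  rw [RootPairing.IsEuclidean.coroot'_eq (P := P) i x,
    div_mul_cancel₀ _ (inner_root_self_pos P i).ne']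

theorem coroot'_pos_iff (i : ι) (x : E) : 0 < P.coroot' i x ↔ 0 < ⟪x, P.root i⟫_ℝ := by
  have h := coroot'_mul_inner P i x
  have h0 := inner_root_self_pos P i
  constructor
  · intro hx; nlinarith [mul_pos hx h0]
  · intro hx; by_contra! hc; nlinarith [mul_nonneg (neg_nonneg.mpr hc) h0.le]

theorem coroot'_nonneg_iff (i : ι) (x : E) : 0 ≤ P.coroot' i x ↔ 0 ≤ ⟪x, P.root i⟫_ℝ := by
  have h := coroot'_mul_inner P i x
  have h0 := inner_root_self_pos P i
  constructor
  · intro hx; nlinarith [mul_nonneg hx h0.le]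
  · intro hx; by_contra! hc; nlinarith [mul_pos (neg_pos.mpr hc) h0]

omit [P.IsEuclidean] in
theorem reflection_eq (i : ι) (x : E) :
    P.reflection i x = x - P.coroot' i x • P.root i := P.reflection_apply i x

theorem inner_reflection (i : ι) (x y : E) :
    ⟪P.reflection i x, P.reflection i y⟫_ℝ = ⟪x, y⟫_ℝ := by
  have hx := coroot'_mul_inner P i x
  have hy := coroot'_mul_inner P i y
  simp only [reflection_eq, inner_sub_left, inner_sub_right, inner_smul_left, inner_smul_right,
    RCLike.conj_to_real, real_inner_comm (P.root i) y] at *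
  linear_combination (P.coroot' i x / 2) * hy + (P.coroot' i y / 2) * hx

theorem inner_weyl_smul (w : P.weylGroup) (x y : E) : ⟪w • x, w • y⟫_ℝ = ⟪x, y⟫_ℝ := by
  obtain ⟨w, hw⟩ := w
  induction hw using RootPairing.weylGroup.induction generalizing x y with
  | mem i => exact inner_reflection P i x y
  | one =>
    change ⟪(1 : P.weylGroup) • x, (1 : P.weylGroup) • y⟫_ℝ = _
    simp
  | mul v w hv hw h₁ h₂ =>
    rw [← Submonoid.mk_mul_mk _ v w hv hw, mul_smul, mul_smul, h₁, h₂]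

theorem inner_weyl_smul_root (w : P.weylGroup) (i : ι) (x : E) :
    ⟪w • x, P.root (P.weylGroupToPerm w i)⟫_ℝ = ⟪x, P.root i⟫_ℝ := by
  rw [← P.weylGroup_apply_root, inner_weyl_smul]

theorem coroot'_weyl_smul (w : P.weylGroup) (i : ι) (x : E) :
    P.coroot' (P.weylGroupToPerm w i) (w • x) = P.coroot' i x := by
  rw [RootPairing.IsEuclidean.coroot'_eq (P := P), RootPairing.IsEuclidean.coroot'_eq (P := P),
    inner_weyl_smul_root, ← P.weylGroup_apply_root, inner_weyl_smul]

omit [P.IsEuclidean] in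
theorem ofIdx_smul_eq (i : ι) (x : E) :
    RootPairing.weylGroup.ofIdx P i • x = x - P.coroot' i x • P.root i := reflection_eq P i x

/-- `μ` is integral if all `⟨μ, α^∨⟩` are integers. -/
def IsIntegral (μ : E) : Prop := ∀ i, ∃ k : ℤ, P.coroot' i μ = k

omit [P.IsEuclidean] in
theorem isIntegral_root [P.IsCrystallographic] (i : ι) : IsIntegral P (P.root i) := fun j => by
  obtain ⟨k, hk⟩ := P.exists_value (S := ℤ) i j
  exact ⟨k, by simpa using hk.symm⟩

variable {P}

omit [P.IsEuclidean] in
theorem IsIntegral.sub {μ ν : E} (hμ : IsIntegral P μ) (hν : IsIntegral P ν) :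
    IsIntegral P (μ - ν) := fun i => by
  obtain ⟨k, hk⟩ := hμ i
  obtain ⟨l, hl⟩ := hν i
  exact ⟨k - l, by rw [map_sub, hk, hl]; push_cast; rfl⟩

omit [P.IsEuclidean] in
theorem IsIntegral.nsmul {μ : E} (hμ : IsIntegral P μ) (n : ℕ) :
    IsIntegral P (n • μ) := fun i => by
  obtain ⟨k, hk⟩ := hμ i
  exact ⟨n * k, by rw [map_nsmul, hk]; simp⟩

theorem IsIntegral.weyl_smul {μ : E} (hμ : IsIntegral P μ) (w : P.weylGroup) :
    IsIntegral P (w • μ) := fun i => by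
  obtain ⟨k, hk⟩ := hμ (P.weylGroupToPerm w⁻¹ i)
  refine ⟨k, ?_⟩
  rw [← hk, ← coroot'_weyl_smul P w (P.weylGroupToPerm w⁻¹ i), ← weylGroupToPerm_mul_apply,
    mul_inv_cancel, map_one]
  rfl

end WeylGroup

/-! ### Simple roots and descent in Weyl orbits -/

section PositiveSystem

variable {ι : Type*} {E : Type*} [NormedAddCommGroup E] [InnerProductSpace ℝ E]
  {N : Type*} [AddCommGroup N] [Module ℝ N] {P : RootPairing ι ℝ E N} {Φ : Finset ι}

theorem IsPositiveSystem.mem_or_neg_mem (hΦ : IsPositiveSystem P Φ) (i : ι) :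
    i ∈ Φ ∨ ∃ j ∈ Φ, P.root j = -P.root i := by
  obtain ⟨γ, hγ, h⟩ := hΦ
  rcases (hγ i).lt_or_gt with hi | hi
  · obtain ⟨j, hj⟩ := exists_root_eq_neg P i
    refine Or.inr ⟨j, (h j).mpr ?_, hj⟩
    rw [hj, inner_neg_right]
    linarith
  · exact Or.inl ((h i).mpr hi)

theorem IsPositiveSystem.add_ne_zero (hΦ : IsPositiveSystem P Φ) {i j : ι} (hi : i ∈ Φ)
    (hj : j ∈ Φ) : P.root i + P.root j ≠ 0 := by
  obtain ⟨γ, hγ, h⟩ := hΦ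
  intro h0
  have := congrArg (fun x => ⟪γ, x⟫_ℝ) h0
  simp only [inner_add_right, inner_zero_right] at this
  linarith [(h i).mp hi, (h j).mp hj]

theorem coroot'_root_self (i : ι) : P.coroot' i (P.root i) = 2 := by simp

theorem coroot'_reflection_self (i : ι) (x : E) :
    P.coroot' i (P.reflection i x) = -P.coroot' i x := by
  rw [reflection_eq, map_sub, map_smul, coroot'_root_self, smul_eq_mul]
  ring

/-- Covers -α and, in the nonreduced case, 2α; later arguments can thus treat multiples of a simple
root as that root. -/
theorem reflection_eq_of_root_eq_smul [P.IsEuclidean] {i j : ι} {t : ℝ}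
    (h : P.root i = t • P.root j) (x : E) : P.reflection i x = P.reflection j x := by
  have ht : t ≠ 0 := by
    rintro rfl
    exact P.ne_zero i (by simpa using h)
  have h0 := (inner_root_self_pos P j).ne'
  rw [reflection_eq, reflection_eq, RootPairing.IsEuclidean.coroot'_eq (P := P) i,
    RootPairing.IsEuclidean.coroot'_eq (P := P) j, h, smul_smul]
  congr 2
  simp only [inner_smul_left, inner_smul_right, RCLike.conj_to_real]
  field_simp

variable (P Φ) in
/-- A simple root is a positive root that is not the sum of two positive roots. -/
def IsSimple (b : ι) : Prop :=
  b ∈ Φ ∧ ∀ j ∈ Φ, ∀ k ∈ Φ, P.root b ≠ P.root j + P.root k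

/-- If r_b α were negative, then δ = -r_b α would satisfy α + δ = k b with k = ⟨α, b^∨⟩ > 0.
Subtracting b from both summands keeps them positive roots and lowers k by 2, until the sum is 0 or
b; the former contradicts positivity, the latter simplicity. -/
theorem IsPositiveSystem.mem_of_reflectionPerm [Finite ι] [P.IsCrystallographic]
    (hΦ : IsPositiveSystem P Φ) {b i : ι} (hb : IsSimple P Φ b) (hi : i ∈ Φ)
    (hib : ∀ t : ℝ, P.root i ≠ t • P.root b) : P.reflectionPerm b i ∈ Φ := by
  -- If the root α - b were negative, b would be the sum of the positive roots α and b - α.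
  have sub_mem : ∀ i ∈ Φ, (∀ t : ℝ, P.root i ≠ t • P.root b) → 0 < P.coroot' b (P.root i) →
      ∃ j ∈ Φ, P.root j = P.root i - P.root b := by
    intro i hi hib hpos
    have hpos' : 0 < P.pairingIn ℤ i b := by
      have : ((P.pairingIn ℤ i b : ℤ) : ℝ) = P.coroot' b (P.root i) := by
        simpa using P.algebraMap_pairingIn ℤ i b
      rw [← this] at hpos
      exact_mod_cast hpos
    have hne : i ≠ b := by
      rintro rfl
      exact hib 1 (by simp)
    obtain ⟨j, hj⟩ := P.root_sub_root_mem_of_pairingIn_pos hpos' hne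
    rcases hΦ.mem_or_neg_mem j with h | ⟨k, hk, hkj⟩
    · exact ⟨j, h, hj⟩
    · exact absurd (by rw [hkj, hj]; abel) (hb.2 i hi k hk)
  have key : ∀ n : ℕ, ∀ i ∈ Φ, ∀ d ∈ Φ, P.root i + P.root d = (n : ℝ) • P.root b →
      (∀ t : ℝ, P.root i ≠ t • P.root b) → P.coroot' b (P.root i) = n → False := by
    intro n
    induction n using Nat.strong_induction_on with
    | _ n ih =>
      intro i hi d hd hsum hib hn
      rcases n with _ | _ | n
      · exact hΦ.add_ne_zero hi hd (by simpa using hsum)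
      · exact hb.2 i hi d hd (by simpa using hsum.symm)
      · have hd' : P.root d = ((n + 1 + 1 : ℕ) : ℝ) • P.root b - P.root i := by
          rw [← hsum]; abel
        have hdb : ∀ t : ℝ, P.root d ≠ t • P.root b := fun t ht =>
          hib (((n + 1 + 1 : ℕ) : ℝ) - t) (by rw [sub_smul, ← ht, hd']; abel)
        have hnd : P.coroot' b (P.root d) = ((n + 1 + 1 : ℕ) : ℝ) := by
          rw [hd', map_sub, map_smul, hn, coroot'_root_self, smul_eq_mul]; ring
        obtain ⟨j, hj, hjr⟩ := sub_mem i hi hib (by rw [hn]; positivity)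
        obtain ⟨e, he, her⟩ := sub_mem d hd hdb (by rw [hnd]; positivity)
        refine ih n (by lia) j hj e he ?_ (fun t ht => hib (t + 1) ?_) ?_
        · rw [hjr, her, hd']; push_cast; module
        · rw [add_smul, ← ht, hjr]; module
        · rw [hjr, map_sub, hn, coroot'_root_self]; push_cast; ring
  by_contra hnot
  rcases hΦ.mem_or_neg_mem (P.reflectionPerm b i) with h | ⟨d, hd, hdr⟩
  · exact hnot h
  rw [P.root_reflectionPerm, reflection_eq] at hdr
  obtain ⟨k, hk⟩ := isIntegral_root P i b
  have hkpos : 0 < k := by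
    by_contra! hle
    obtain ⟨γ, -, h⟩ := hΦ
    have h1 := (h d).mp hd
    have h2 := (h i).mp hi
    have h3 := (h b).mp hb.1
    rw [hdr, hk, inner_neg_right, inner_sub_right, inner_smul_right] at h1
    have : (k : ℝ) ≤ 0 := by exact_mod_cast hle
    nlinarith
  lift k to ℕ using hkpos.le
  exact key k i hi d hd (by rw [hdr, hk]; simp) hib (by simpa using hk)

/-- The heights ⟨γ, α⟩ are real, but Φ is finite, so a counterexample of least height exists. -/
theorem IsPositiveSystem.induction (hΦ : IsPositiveSystem P Φ) {p : ι → Prop}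
    (h : ∀ γ : E, (∀ j ∈ Φ, 0 < ⟪γ, P.root j⟫_ℝ) → ∀ i ∈ Φ,
      (∀ j ∈ Φ, ⟪γ, P.root j⟫_ℝ < ⟪γ, P.root i⟫_ℝ → p j) → p i) :
    ∀ i ∈ Φ, p i := by
  classical
  obtain ⟨γ, hγ, hγΦ⟩ := hΦ
  by_contra! hex
  obtain ⟨i₀, hi₀, hp₀⟩ := hex
  obtain ⟨i, hi, hmin⟩ := Finset.exists_min_image (Φ.filter fun i => ¬ p i)
    (fun i => ⟪γ, P.root i⟫_ℝ) ⟨i₀, by simp [hi₀, hp₀]⟩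
  rw [Finset.mem_filter] at hi
  refine hi.2 (h γ (fun j hj => (hγΦ j).mp hj) i hi.1 fun j hj hlt => ?_)
  by_contra hpj
  exact absurd (hmin j (by simp [hj, hpj])) (not_le.mpr hlt)

theorem IsPositiveSystem.root_mem_closure_simple (hΦ : IsPositiveSystem P Φ) :
    ∀ i ∈ Φ, P.root i ∈ AddSubmonoid.closure (P.root '' {b | IsSimple P Φ b}) := by
  refine hΦ.induction fun γ hγ i hi ih => ?_
  by_cases hs : IsSimple P Φ i
  · exact AddSubmonoid.subset_closure ⟨i, hs, rfl⟩
  · unfold IsSimple at hs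
    push Not at hs
    obtain ⟨j, hj, k, hk, hjk⟩ := hs hi
    rw [hjk]
    have hjpos := hγ j hj
    have hkpos := hγ k hk
    refine add_mem (ih j hj ?_) (ih k hk ?_) <;> rw [hjk, inner_add_right] <;> linarith

/-- Otherwise α, being a sum of simple roots, would have ⟨α, α⟩ ≤ 0. -/
theorem IsPositiveSystem.exists_simple_inner_pos (hΦ : IsPositiveSystem P Φ) {i : ι}
    (hi : i ∈ Φ) : ∃ b, IsSimple P Φ b ∧ 0 < ⟪P.root i, P.root b⟫_ℝ := by
  by_contra! hle
  have h : ∀ y ∈ AddSubmonoid.closure (P.root '' {b | IsSimple P Φ b}),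
      ⟪P.root i, y⟫_ℝ ≤ 0 := by
    intro y hy
    induction hy using AddSubmonoid.closure_induction with
    | mem y hy => obtain ⟨b, hb, rfl⟩ := hy; exact hle b hb
    | zero => simp
    | add y z _ _ hy hz => rw [inner_add_right]; linarith
  exact absurd (h _ (hΦ.root_mem_closure_simple i hi)) (not_le.mpr (inner_root_self_pos P i))

/-- For b simple with ⟨α, b⟩ > 0, the root r_b α is positive of smaller height, and r_α = r_b r_{r_b
α} r_b. This is the generation of W by simple reflections. -/
theorem IsPositiveSystem.reflection_mem_of_simple [Finite ι] [P.IsCrystallographic]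
    [P.IsEuclidean] (hΦ : IsPositiveSystem P Φ) {O : Set E}
    (hO : ∀ b, IsSimple P Φ b → ∀ x ∈ O, P.reflection b x ∈ O) :
    ∀ i ∈ Φ, ∀ x ∈ O, P.reflection i x ∈ O := by
  refine hΦ.induction fun γ hγ i hi ih x hx => ?_
  obtain ⟨b, hb, hbpos⟩ := hΦ.exists_simple_inner_pos hi
  by_cases hib : ∃ t : ℝ, P.root i = t • P.root b
  · obtain ⟨t, ht⟩ := hib
    rw [reflection_eq_of_root_eq_smul ht]
    exact hO b hb x hx
  · push Not at hib
    have hj := hΦ.mem_of_reflectionPerm hb hi hib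
    have hlt : ⟪γ, P.root (P.reflectionPerm b i)⟫_ℝ < ⟪γ, P.root i⟫_ℝ := by
      rw [P.root_reflectionPerm, reflection_eq, inner_sub_right, inner_smul_right]
      nlinarith [mul_pos ((coroot'_pos_iff P b _).mpr hbpos) (hγ b hb.1)]
    have h := hO b hb _ (ih _ hj hlt _ (hO b hb x hx))
    rw [P.reflection_reflectionPerm] at h
    simpa using h

theorem IsPositiveSystem.weyl_smul_mem [Finite ι] [P.IsCrystallographic]
    [P.IsEuclidean] (hΦ : IsPositiveSystem P Φ) {O : Set E}
    (hO : ∀ b, IsSimple P Φ b → ∀ x ∈ O, P.reflection b x ∈ O) (w : P.weylGroup) :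
    ∀ x ∈ O, w • x ∈ O := by
  have hall : ∀ i, ∀ x ∈ O, P.reflection i x ∈ O := by
    intro i x hx
    rcases hΦ.mem_or_neg_mem i with hi | ⟨j, hj, hji⟩
    · exact hΦ.reflection_mem_of_simple hO i hi x hx
    · rw [reflection_eq_of_root_eq_smul (i := i) (j := j) (t := -1) (by rw [hji]; simp)]
      exact hΦ.reflection_mem_of_simple hO j hj x hx
  obtain ⟨w, hw⟩ := w
  induction hw using RootPairing.weylGroup.induction with
  | mem i => exact hall i
  | one => exact fun x hx => (one_smul P.weylGroup x).symm ▸ hx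
  | mul v w hv hw h₁ h₂ =>
    intro x hx
    rw [← Submonoid.mk_mul_mk _ v w hv hw, mul_smul]
    exact h₁ _ (h₂ x hx)

variable (P Φ) in
/-- `Descends P Φ ν m κ` means that `κ` arises from `ν` by `m` simple reflections, each of which
lowers its argument. -/
inductive Descends (ν : E) : ℕ → E → Prop
  | refl : Descends ν 0 ν
  | step {m : ℕ} {κ : E} {b : ι} (hb : IsSimple P Φ b) (h : Descends ν m κ)
      (hpos : 0 < P.coroot' b κ) : Descends ν (m + 1) (P.reflection b κ)

/-- A form of the exchange property. Write κ = r_b κ' for the last step. Unless α is a multiple of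
b, the root r_b α is positive and its coroot is negative on κ', so by induction its reflection
shortens the descent to κ'; and r_α κ = r_b r_{r_b α} κ'. -/
theorem Descends.exists_reflection [Finite ι] [P.IsCrystallographic] [P.IsEuclidean]
    (hΦ : IsPositiveSystem P Φ) {ν : E} (hν : ∀ i ∈ Φ, 0 ≤ P.coroot' i ν) {m : ℕ} :
    ∀ {κ : E}, Descends P Φ ν m κ → ∀ i ∈ Φ, P.coroot' i κ < 0 →
      ∃ l < m, Descends P Φ ν l (P.reflection i κ) := by
  induction m using Nat.strong_induction_on with
  | _ m ih =>
    intro κ hκ i hi hneg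
    cases hκ with
    | refl => exact absurd (hν i hi) (not_le.mpr hneg)
    | @step m κ b hb h hpos =>
      by_cases hib : ∃ t : ℝ, P.root i = t • P.root b
      · obtain ⟨t, ht⟩ := hib
        refine ⟨m, m.lt_succ_self, ?_⟩
        rw [reflection_eq_of_root_eq_smul ht]
        simpa using h
      · push Not at hib
        have hj := hΦ.mem_of_reflectionPerm hb hi hib
        have hcor : P.coroot' (P.reflectionPerm b i) κ = P.coroot' i (P.reflection b κ) := by
          have := coroot'_weyl_smul P (RootPairing.weylGroup.ofIdx P b) i (P.reflection b κ)
          rw [← this]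
          congr 1
          exact (by simp : κ = P.reflection b (P.reflection b κ))
        obtain ⟨l, hl, hD⟩ := ih m m.lt_succ_self h _ hj (by rw [hcor]; exact hneg)
        have heq : P.reflection i (P.reflection b κ) =
            P.reflection b (P.reflection (P.reflectionPerm b i) κ) := by
          rw [P.reflection_reflectionPerm]
          simp
        rw [heq]
        -- The outer r_b is a lowering step only for a positive value. For a negative value the
        -- induction hypothesis is needed again, at a length other than m, so the induction is
        -- strong.
        rcases lt_trichotomy (P.coroot' b (P.reflection (P.reflectionPerm b i) κ)) 0 with h | h | h
        · obtain ⟨l', hl', hD'⟩ := ih l (by lia) hD b hb.1 h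
          exact ⟨l', by lia, hD'⟩
        · refine ⟨l, by lia, ?_⟩
          rwa [reflection_eq P b, h, zero_smul, sub_zero]
        · exact ⟨l + 1, by lia, hD.step hb h⟩

/-- The points reached by descent are closed under simple reflections: one that would raise the
point is handled by the exchange property. Hence they fill the orbit. -/
theorem exists_descends [Finite ι] [P.IsCrystallographic] [P.IsEuclidean]
    (hΦ : IsPositiveSystem P Φ) {ν : E} (hν : ∀ i ∈ Φ, 0 ≤ P.coroot' i ν) (w : P.weylGroup) :
    ∃ m, Descends P Φ ν m (w • ν) := by
  refine hΦ.weyl_smul_mem (O := {κ | ∃ m, Descends P Φ ν m κ}) ?_ w ν ⟨0, .refl⟩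
  rintro b hb κ ⟨m, hm⟩
  rcases lt_trichotomy (P.coroot' b κ) 0 with h | h | h
  · obtain ⟨l, -, hl⟩ := hm.exists_reflection hΦ hν b hb.1 h
    exact ⟨l, hl⟩
  · refine ⟨m, ?_⟩
    rwa [reflection_eq, h, zero_smul, sub_zero]
  · exact ⟨m + 1, hm.step hb h⟩

end PositiveSystem

/-! ### Dominant weights and the natural order -/

section Dominance

variable {ι : Type*} {E : Type*} [NormedAddCommGroup E] [InnerProductSpace ℝ E]
  {N : Type*} [AddCommGroup N] [Module ℝ N] {P : RootPairing ι ℝ E N} {Φ : Finset ι}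

theorem Preceq.refl (μ : E) : Preceq P Φ μ μ := by
  simp [Preceq]

theorem Preceq.trans {μ ν κ : E} (h₁ : Preceq P Φ μ ν) (h₂ : Preceq P Φ ν κ) :
    Preceq P Φ μ κ := by
  have := add_mem h₂ h₁
  rwa [sub_add_sub_cancel] at this

theorem preceq_sub_nsmul {i : ι} (hi : i ∈ Φ) (n : ℕ) (μ : E) :
    Preceq P Φ (μ - n • P.root i) μ := by
  unfold Preceq
  rw [sub_sub_cancel]
  exact nsmul_mem (AddSubmonoid.subset_closure (Set.mem_image_of_mem _ (Finset.mem_coe.mpr hi))) n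

theorem IsDominant.coroot'_nonneg {μ : E} (hμ : IsDominant P Φ μ) {i : ι} (hi : i ∈ Φ) :
    0 ≤ P.coroot' i μ := by
  obtain ⟨k, hk⟩ := hμ i hi
  rw [hk]
  positivity

section Euclidean

variable [P.IsEuclidean]

theorem IsDominant.inner_nonneg {μ : E} (hμ : IsDominant P Φ μ) {i : ι} (hi : i ∈ Φ) :
    0 ≤ ⟪μ, P.root i⟫_ℝ :=
  (coroot'_nonneg_iff P i μ).mp (hμ.coroot'_nonneg hi)

omit [P.IsEuclidean] in
theorem inner_nonneg_of_mem_closure {μ : E} (hμ : ∀ i ∈ Φ, 0 ≤ ⟪μ, P.root i⟫_ℝ) {x : E}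
    (hx : x ∈ AddSubmonoid.closure (P.root '' (Φ : Set ι))) : 0 ≤ ⟪μ, x⟫_ℝ := by
  induction hx using AddSubmonoid.closure_induction with
  | mem y hy => obtain ⟨i, hi, rfl⟩ := hy; exact hμ i hi
  | zero => simp
  | add y z _ _ hy hz => rw [inner_add_right]; exact add_nonneg hy hz

theorem IsDominant.isIntegral (hΦ : IsPositiveSystem P Φ) {μ : E} (hμ : IsDominant P Φ μ) :
    IsIntegral P μ := by
  intro i
  rcases hΦ.mem_or_neg_mem i with hi | ⟨j, hj, hji⟩
  · obtain ⟨k, hk⟩ := hμ i hi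
    exact ⟨k, by simpa using hk⟩
  · obtain ⟨k, hk⟩ := hμ j hj
    refine ⟨-k, ?_⟩
    rw [RootPairing.IsEuclidean.coroot'_eq (P := P), hji, inner_neg_right, inner_neg_left,
      inner_neg_right, neg_neg] at hk
    rw [RootPairing.IsEuclidean.coroot'_eq (P := P)]
    push_cast
    rw [← hk]
    ring

/-- The missing term 2⟨μ, ν - μ⟩ is nonnegative. Antisymmetry of the order, finiteness below a
weight and the growth of ε all come from this. -/
theorem IsDominant.inner_self_sub_le {μ ν : E} (hμ : IsDominant P Φ μ) (h : Preceq P Φ μ ν) :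
    ⟪μ, μ⟫_ℝ + ⟪ν - μ, ν - μ⟫_ℝ ≤ ⟪ν, ν⟫_ℝ := by
  have := inner_nonneg_of_mem_closure (fun i hi => hμ.inner_nonneg hi) h
  have h' : ⟪ν, ν⟫_ℝ = ⟪μ, μ⟫_ℝ + ⟪ν - μ, ν - μ⟫_ℝ + 2 * ⟪μ, ν - μ⟫_ℝ := by
    simp only [inner_sub_left, inner_sub_right, real_inner_comm μ ν]
    ring
  linarith

theorem IsDominant.preceq_antisymm {μ ν : E} (hμ : IsDominant P Φ μ) (hν : IsDominant P Φ ν)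
    (h : Preceq P Φ μ ν) (h' : Preceq P Φ ν μ) : μ = ν := by
  have h1 := hμ.inner_self_sub_le h
  have h2 := hν.inner_self_sub_le h'
  have h3 : 0 ≤ ⟪μ - ν, μ - ν⟫_ℝ := real_inner_self_nonneg
  have h4 : ⟪ν - μ, ν - μ⟫_ℝ = 0 := le_antisymm (by linarith) real_inner_self_nonneg
  exact (sub_eq_zero.mp (inner_self_eq_zero.mp h4)).symm

end Euclidean

variable [Finite ι] [P.IsCrystallographic] [P.IsEuclidean]

omit [Finite ι] [P.IsCrystallographic] in
theorem Descends.isIntegral_and_preceq {ν : E} (hν : IsIntegral P ν) {m : ℕ} {κ : E}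
    (h : Descends P Φ ν m κ) : IsIntegral P κ ∧ Preceq P Φ κ ν := by
  induction h with
  | refl => exact ⟨hν, .refl ν⟩
  | @step m κ b hb _ hpos ih =>
    refine ⟨ih.1.weyl_smul (RootPairing.weylGroup.ofIdx P b), Preceq.trans ?_ ih.2⟩
    obtain ⟨k, hk⟩ := ih.1 b
    rw [hk] at hpos
    lift k to ℕ using (by exact_mod_cast hpos.le)
    have := preceq_sub_nsmul (P := P) hb.1 k κ
    rwa [← Nat.cast_smul_eq_nsmul ℝ, ← Int.cast_natCast (R := ℝ) k, ← hk, ← reflection_eq] at this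

theorem IsDominant.weyl_smul_preceq (hΦ : IsPositiveSystem P Φ) {ν : E}
    (hν : IsDominant P Φ ν) (w : P.weylGroup) : Preceq P Φ (w • ν) ν := by
  obtain ⟨m, hm⟩ := exists_descends hΦ (fun i hi => hν.coroot'_nonneg hi) w
  exact (hm.isIntegral_and_preceq (hν.isIntegral hΦ)).2

/-- The last step r_b of a nontrivial descent ends at a point where b^∨ is negative, hence not at a
dominant weight. -/
theorem IsDominant.eq_of_mem_orbit (hΦ : IsPositiveSystem P Φ) {μ ν : E}
    (hμ : IsDominant P Φ μ) (hν : IsDominant P Φ ν)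
    (h : μ ∈ MulAction.orbit P.weylGroup ν) : μ = ν := by
  obtain ⟨w, rfl⟩ := h
  obtain ⟨m, hm⟩ := exists_descends hΦ (fun i hi => hν.coroot'_nonneg hi) w
  change w • ν = ν
  change IsDominant P Φ (w • ν) at hμ
  generalize w • ν = κ at *
  cases hm with
  | refl => rfl
  | @step m κ b hb _ hpos =>
    have := hμ.coroot'_nonneg hb.1
    rw [coroot'_reflection_self] at this
    linarith

omit [P.IsCrystallographic] in
-- A point of the finite orbit that maximizes ⟨γ, ·⟩ is dominant.
theorem exists_dominant_mem_orbit [P.IsRootSystem] (hΦ : IsPositiveSystem P Φ) {μ : E}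
    (hμ : IsIntegral P μ) : ∃ w : P.weylGroup, IsDominant P Φ (w • μ) := by
  obtain ⟨γ, hγ, hγΦ⟩ := hΦ
  obtain ⟨w, hw⟩ := Finite.exists_max fun w : P.weylGroup => ⟪γ, w • μ⟫_ℝ
  refine ⟨w, fun i hi => ?_⟩
  have hle : 0 ≤ P.coroot' i (w • μ) := by
    have h := hw (RootPairing.weylGroup.ofIdx P i * w)
    rw [mul_smul, ofIdx_smul_eq, inner_sub_right, inner_smul_right] at h
    have := (hγΦ i).mp hi
    by_contra! hneg
    nlinarith [mul_pos (neg_pos.mpr hneg) this]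
  obtain ⟨k, hk⟩ := hμ.weyl_smul w i
  rw [hk] at hle
  lift k to ℕ using (by exact_mod_cast hle)
  exact ⟨k, by simpa using hk⟩

omit [Finite ι] [P.IsCrystallographic] in
-- The value l(k - l) determines l up to l ↔ k - l; this locates an orbit on a root string.
theorem inner_self_sub_nsmul_root {μ : E} {i : ι} {k : ℕ} (hk : P.coroot' i μ = k) (l : ℕ) :
    ⟪μ - l • P.root i, μ - l • P.root i⟫_ℝ =
      ⟪μ, μ⟫_ℝ - l * ((k : ℝ) - l) * ⟪P.root i, P.root i⟫_ℝ := by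
  have h := coroot'_mul_inner P i μ
  rw [hk] at h
  rw [← Nat.cast_smul_eq_nsmul ℝ]
  simp only [inner_sub_left, inner_sub_right, inner_smul_left, inner_smul_right,
    RCLike.conj_to_real, real_inner_comm μ (P.root i)]
  linear_combination (l : ℝ) * h

/-- Let w carry μ - lα to ν. If wα is positive, then ν = wμ - l wα ⪯ wμ ⪯ μ. Otherwise the same
argument applies to μ - lα = r_α μ + (k - l)α. -/
theorem IsDominant.preceq_of_sub_nsmul_mem_orbit (hΦ : IsPositiveSystem P Φ) {μ ν : E}
    (hμ : IsDominant P Φ μ) {i : ι} {k l : ℕ} (hk : P.coroot' i μ = k)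
    (hlk : l ≤ k) (h : μ - l • P.root i ∈ MulAction.orbit P.weylGroup ν) :
    Preceq P Φ ν μ := by
  obtain ⟨w, hw⟩ := MulAction.mem_orbit_symm.mp h
  change w • (μ - l • P.root i) = ν at hw
  rw [smul_sub, smul_nsmul_eq, P.weylGroup_apply_root] at hw
  rcases hΦ.mem_or_neg_mem (P.weylGroupToPerm w i) with hi | ⟨j, hj, hji⟩
  · rw [← hw]
    exact (preceq_sub_nsmul hi l _).trans (hμ.weyl_smul_preceq hΦ w)
  · have h' : ν = (w * RootPairing.weylGroup.ofIdx P i) • μ - (k - l) • P.root j := by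
      rw [mul_smul, ofIdx_smul_eq, hk, smul_sub, smul_real_smul, P.weylGroup_apply_root, hji,
        ← hw, ← Nat.cast_smul_eq_nsmul ℝ (k - l), Nat.cast_sub hlk, ← Nat.cast_smul_eq_nsmul ℝ l]
      generalize w • μ = x
      module
    rw [h']
    exact (preceq_sub_nsmul hj _ _).trans (hμ.weyl_smul_preceq hΦ _)

omit [Finite ι] [P.IsCrystallographic] in
theorem ne_of_sub_nsmul_mem_orbit {μ ν : E} {i : ι} {k l : ℕ} (hk : P.coroot' i μ = k)
    (hl : 0 < l) (hlk : l < k) (h : μ - l • P.root i ∈ MulAction.orbit P.weylGroup ν) :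
    ν ≠ μ := by
  rintro rfl
  obtain ⟨w, hw⟩ := h
  change w • ν = _ at hw
  have h1 := inner_self_sub_nsmul_root hk l
  rw [← hw, inner_weyl_smul] at h1
  have h2 : (0 : ℝ) < l := by exact_mod_cast hl
  have h3 : (0 : ℝ) < k - l := by
    rw [sub_pos]; exact_mod_cast hlk
  have := mul_pos (mul_pos h2 h3) (inner_root_self_pos P i)
  linarith

omit [P.IsCrystallographic] in
-- A weight is determined by its coroot values, which are integers bounded by means of ‖μ‖ ≤ ‖lam‖.
theorem finite_dominantBelow [P.IsRootSystem] (hΦ : IsPositiveSystem P Φ) (lam : E) :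
    (dominantBelow P Φ lam).Finite := by
  have hinj : Set.InjOn (fun (μ : E) (i : ι) => P.coroot' i μ) (dominantBelow P Φ lam) := by
    intro μ _ ν _ h
    refine sub_eq_zero.mp (eq_zero_of_inner_root_eq_zero P fun i => ?_)
    have h1 := coroot'_mul_inner P i (μ - ν)
    rw [map_sub, show P.coroot' i μ = P.coroot' i ν from congrFun h i, sub_self, zero_mul] at h1
    rw [real_inner_comm]
    linarith
  refine Set.Finite.of_finite_image ?_ hinj
  let B : ι → ℝ := fun i => 2 * (‖lam‖ * ‖P.root i‖) / ⟪P.root i, P.root i⟫_ℝ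
  refine (Set.Finite.pi (t := fun i => (fun k : ℤ => (k : ℝ)) '' Set.Icc (-⌈B i⌉) ⌈B i⌉)
    fun i => (Set.finite_Icc _ _).image _).subset ?_
  rintro _ ⟨μ, hμ, rfl⟩ i -
  obtain ⟨k, hk⟩ := hμ.1.isIntegral hΦ i
  refine ⟨k, ?_, hk.symm⟩
  have hnorm : ‖μ‖ ≤ ‖lam‖ := by
    have h1 := hμ.1.inner_self_sub_le hμ.2
    have h2 : 0 ≤ ⟪lam - μ, lam - μ⟫_ℝ := real_inner_self_nonneg
    rw [norm_eq_sqrt_real_inner μ, norm_eq_sqrt_real_inner lam]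
    exact Real.sqrt_le_sqrt (by linarith)
  have habs : |(k : ℝ)| ≤ B i := by
    have h0 := inner_root_self_pos P i
    rw [← hk, RootPairing.IsEuclidean.coroot'_eq (P := P), abs_div, abs_of_pos h0, abs_mul,
      abs_of_pos (two_pos : (0 : ℝ) < 2)]
    have h1 := abs_real_inner_le_norm μ (P.root i)
    have h2 := mul_le_mul_of_nonneg_right hnorm (norm_nonneg (P.root i))
    refine div_le_div_of_nonneg_right ?_ h0.le
    linarith
  have h1 := abs_le.mp (habs.trans (Int.le_ceil _))
  constructor
  · exact_mod_cast h1.1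
  · exact_mod_cast h1.2

end Dominance

/-! ### Monotonicity of the eigenvalues -/

section Rho

variable {ι : Type*} {E : Type*} [NormedAddCommGroup E] [InnerProductSpace ℝ E]
  {N : Type*} [AddCommGroup N] [Module ℝ N] {P : RootPairing ι ℝ E N} {Φ : Finset ι}
  [P.IsEuclidean]

/-- The β ∈ Φ with r_α β ∈ Φ are permuted by r_α, and their contributions cancel. If r_α β ∉ Φ, then
⟨β, α^∨⟩ ≥ 0, for otherwise r_α β would be β plus a positive multiple of α, hence positive. -/
theorem inner_rho_nonneg (hΦ : IsPositiveSystem P Φ) {g : ι → ℝ} (hg : ∀ i, 0 ≤ g i)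
    (hgW : ∀ (w : P.weylGroup) (i : ι), g (P.weylGroupToPerm w i) = g i) {i : ι} (hi : i ∈ Φ) :
    0 ≤ ⟪rho P Φ g, P.root i⟫_ℝ := by
  classical
  set s : ι → ι := fun j => P.reflectionPerm i j
  have hs : ∀ j, s (s j) = j := fun j => by simp [s]
  have hgs : ∀ j, g (s j) = g j := fun j => hgW (RootPairing.weylGroup.ofIdx P i) j
  have hroot : ∀ j, P.root (s j) = P.root j - P.coroot' i (P.root j) • P.root i := fun j => by
    rw [← reflection_eq, ← P.root_reflectionPerm]
  have hinner : ∀ j, ⟪P.root (s j), P.root i⟫_ℝ = -⟪P.root j, P.root i⟫_ℝ := fun j => by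
    rw [hroot, inner_sub_left, inner_smul_left, RCLike.conj_to_real, coroot'_mul_inner]
    ring
  have h1 : ∑ j ∈ Φ with s j ∈ Φ, g j * ⟪P.root j, P.root i⟫_ℝ = 0 := by
    have : ∑ j ∈ Φ with s j ∈ Φ, g j * ⟪P.root j, P.root i⟫_ℝ =
        ∑ j ∈ Φ with s j ∈ Φ, g (s j) * ⟪P.root (s j), P.root i⟫_ℝ := by
      refine Finset.sum_nbij' s s ?_ ?_ ?_ ?_ ?_ <;> simp +contextual [hs]
    simp only [hgs, hinner, mul_neg, Finset.sum_neg_distrib] at this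
    linarith
  have h2 : 0 ≤ ∑ j ∈ Φ with s j ∉ Φ, g j * ⟪P.root j, P.root i⟫_ℝ := by
    refine Finset.sum_nonneg fun j hj => mul_nonneg (hg j) ?_
    rw [Finset.mem_filter] at hj
    obtain ⟨γ, hγ, hγΦ⟩ := hΦ
    rw [← coroot'_nonneg_iff]
    by_contra! hneg
    refine hj.2 ((hγΦ _).mpr ?_)
    rw [hroot, inner_sub_right, inner_smul_right]
    have h3 := (hγΦ j).mp hj.1
    have h4 := (hγΦ i).mp hi
    nlinarith [mul_pos (neg_pos.mpr hneg) h4]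
  have h3 : ⟪rho P Φ g, P.root i⟫_ℝ = 1 / 2 * ∑ j ∈ Φ, g j * ⟪P.root j, P.root i⟫_ℝ := by
    simp only [rho, inner_smul_left, sum_inner, RCLike.conj_to_real]
  rw [h3, ← Finset.sum_filter_add_sum_filter_not Φ (fun j => s j ∈ Φ), h1, zero_add]
  linarith

/-- ε_ν - ε_μ = |ν|² - |μ|² + 2⟨ρ_g, ν - μ⟩, where the last term is nonnegative and the rest
positive. All denominators of the theorem are nonzero for this reason. -/
theorem eps_lt_eps (hΦ : IsPositiveSystem P Φ) {g : ι → ℝ} (hg : ∀ i, 0 ≤ g i)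
    (hgW : ∀ (w : P.weylGroup) (i : ι), g (P.weylGroupToPerm w i) = g i) {μ ν : E}
    (hμ : IsDominant P Φ μ) (h : Preceq P Φ μ ν) (hne : μ ≠ ν) :
    eps P Φ g μ < eps P Φ g ν := by
  have h1 := hμ.inner_self_sub_le h
  have h2 : 0 ≤ ⟪rho P Φ g, ν - μ⟫_ℝ :=
    inner_nonneg_of_mem_closure (fun i hi => inner_rho_nonneg hΦ hg hgW hi) h
  have h3 : 0 < ⟪ν - μ, ν - μ⟫_ℝ := real_inner_self_pos.mpr (sub_ne_zero.mpr hne.symm)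
  rw [inner_sub_right] at h2
  simp only [eps, inner_add_left, inner_add_right, real_inner_comm (rho P Φ g)] at *
  linarith

omit [P.IsEuclidean] in
-- The form in which ε_μ appears as a diagonal entry of the Laplacian.
theorem eps_eq (g : ι → ℝ) (μ : E) :
    eps P Φ g μ = ⟪μ, μ⟫_ℝ + ∑ i ∈ Φ, g i * ⟪μ, P.root i⟫_ℝ := by
  have : 2 * ⟪μ, rho P Φ g⟫_ℝ = ∑ i ∈ Φ, g i * ⟪μ, P.root i⟫_ℝ := by
    simp only [rho, inner_smul_right, inner_sum]
    ring
  rw [eps, ← this]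
  simp only [inner_add_left, inner_add_right, real_inner_comm (rho P Φ g) μ]
  rw [real_inner_comm μ (rho P Φ g)]
  ring

end Rho

/-! ### The characters e^μ -/

section Expo

variable {E : Type*} [NormedAddCommGroup E] [InnerProductSpace ℝ E]

theorem expo_add (μ ν x : E) : expo (μ + ν) x = expo μ x * expo ν x := by
  simp only [expo, inner_add_left, Complex.ofReal_add, mul_add, Complex.exp_add]

theorem expo_zero (x : E) : expo 0 x = 1 := by simp [expo]

theorem expo_neg_mul (μ x : E) : expo (-μ) x * expo μ x = 1 := by
  rw [← expo_add, neg_add_cancel, expo_zero]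

theorem expo_nsmul (n : ℕ) (μ x : E) : expo (n • μ) x = expo μ x ^ n := by
  induction n with
  | zero => simp [expo_zero]
  | succ n ih => rw [succ_nsmul, expo_add, ih, pow_succ]

theorem expo_sub_nsmul (ν α x : E) (n : ℕ) :
    expo (ν - n • α) x = expo ν x * expo (-α) x ^ n := by
  rw [← expo_nsmul, ← expo_add, smul_neg, sub_eq_add_neg]

theorem conj_expo (μ x : E) : conj (expo μ x) = expo (-μ) x := by
  simp only [expo, ← Complex.exp_conj, map_mul, Complex.conj_I, Complex.conj_ofReal,
    inner_neg_left, Complex.ofReal_neg]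
  ring_nf

end Expo

/-! ### The Laplacian on orbit sums -/

noncomputable section Operator

variable {ι : Type*} {E : Type*} [NormedAddCommGroup E] [InnerProductSpace ℝ E]
  {N : Type*} [AddCommGroup N] [Module ℝ N] (P : RootPairing ι ℝ E N)

instance fintypeWeylGroup [Finite ι] [P.IsRootSystem] : Fintype P.weylGroup :=
  Fintype.ofFinite _

/-- The fibres of w ↦ wμ are cosets of the stabilizer. -/
theorem sum_weyl_smul [Finite ι] [P.IsRootSystem] (f : E → ℂ) (μ : E) :
    ∑ w : P.weylGroup, f (w • μ) =
      stabOrder P μ * ∑ᶠ ν ∈ MulAction.orbit P.weylGroup μ, f ν := by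
  classical
  have hfin : (MulAction.orbit P.weylGroup μ).Finite := Set.finite_range _
  rw [finsum_mem_eq_finite_toFinset_sum _ hfin, Finset.mul_sum,
    ← Finset.sum_fiberwise_of_maps_to (s := Finset.univ) (t := hfin.toFinset)
      (g := fun w : P.weylGroup => w • μ) (fun w _ => by simp)]
  refine Finset.sum_congr rfl fun ν hν => ?_
  rw [Set.Finite.mem_toFinset] at hν
  obtain ⟨v, rfl⟩ := hν
  change _ = _ * f (v • μ)
  rw [Finset.sum_congr rfl (g := fun _ => f (v • μ))
    (fun w hw => by rw [(Finset.mem_filter.mp hw).2]), Finset.sum_const, nsmul_eq_mul]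
  congr 2
  rw [stabOrder, Nat.card_eq_fintype_card, Fintype.card_subtype]
  refine Finset.card_bij' (fun w _ => v⁻¹ * w) (fun w _ => v * w) ?_ ?_ ?_ ?_
  · intro w hw
    have hw' : w • μ = v • μ := (Finset.mem_filter.mp hw).2
    simp [MulAction.mem_stabilizer_iff, mul_smul, hw']
  · intro w hw
    have hw' : w • μ = μ := by simpa [MulAction.mem_stabilizer_iff] using hw
    simp [mul_smul, hw']
  · simp
  · simp

/-- The sum of `e^{wμ}` over the Weyl group. -/
def weylSum [Finite ι] [P.IsRootSystem] (μ x : E) : ℂ :=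
  ∑ w : P.weylGroup, expo (w • μ) x

theorem weylSum_eq [Finite ι] [P.IsRootSystem] (μ x : E) :
    weylSum P μ x = stabOrder P μ * monomial P μ x :=
  sum_weyl_smul P (fun ν => expo ν x) μ

theorem stabOrder_ne_zero [Finite ι] [P.IsRootSystem] (μ : E) : stabOrder P μ ≠ 0 :=
  Nat.card_pos.ne'

theorem monomial_eq [Finite ι] [P.IsRootSystem] (μ x : E) :
    monomial P μ x = (stabOrder P μ : ℂ)⁻¹ * weylSum P μ x := by
  rw [weylSum_eq, inv_mul_cancel_left₀ (Nat.cast_ne_zero.mpr (stabOrder_ne_zero P μ))]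

theorem weylSum_smul [Finite ι] [P.IsRootSystem] (w : P.weylGroup) (μ x : E) :
    weylSum P (w • μ) x = weylSum P μ x := by
  simp only [weylSum, ← mul_smul]
  exact Fintype.sum_equiv (Equiv.mulRight w) _ _ fun v => rfl

/-- The Fourier polynomial `(e^ν - e^{r_α ν}) (1 + e^{-α}) / (1 - e^{-α})`, for
`⟨ν, α^∨⟩ ∈ ℕ`. -/
def stringSum (i : ι) (ν x : E) : ℂ :=
  ∑ l ∈ Finset.range ⌊P.coroot' i ν⌋₊,
    (expo (ν - l • P.root i) x + expo (ν - (l + 1) • P.root i) x)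

theorem one_sub_mul_stringSum {i : ι} {ν : E} {k : ℕ} (hk : P.coroot' i ν = k) (x : E) :
    (1 - expo (-P.root i) x) * stringSum P i ν x =
      (1 + expo (-P.root i) x) * (expo ν x - expo (P.reflection i ν) x) := by
  have hrefl : P.reflection i ν = ν - k • P.root i := by
    rw [reflection_eq, hk, Nat.cast_smul_eq_nsmul]
  have hsum : stringSum P i ν x = expo ν x * (1 + expo (-P.root i) x) *
      ∑ l ∈ Finset.range k, expo (-P.root i) x ^ l := by
    rw [stringSum, hk, Nat.floor_natCast, Finset.mul_sum]
    refine Finset.sum_congr rfl fun l _ => ?_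
    rw [expo_sub_nsmul, expo_sub_nsmul, pow_succ]
    ring
  have h := mul_neg_geom_sum (expo (-P.root i) x) k
  rw [hsum, hrefl, expo_sub_nsmul]
  linear_combination expo ν x * (1 + expo (-P.root i) x) * h

/-- The Fourier polynomial `(1 + e^{-α}) / (1 - e^{-α}) ∂_α M_μ`, where `M_μ` is the sum of
`e^{wμ}` over the Weyl group. -/
def stringTerm [Finite ι] [P.IsRootSystem] (i : ι) (μ x : E) : ℂ :=
  ∑ w : P.weylGroup, (⟪w • μ, P.root i⟫_ℝ : ℂ) * stringSum P i (w • μ) x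

/-- The derivative of `M_μ` in the direction of a root, divided by the imaginary unit. -/
def rootDeriv [Finite ι] [P.IsRootSystem] (i : ι) (μ x : E) : ℂ :=
  ∑ w : P.weylGroup, (⟪w • μ, P.root i⟫_ℝ : ℂ) * expo (w • μ) x

/-- In ∂_α M_μ the exponents ν and r_α ν are taken together, their factors ⟨ν, α⟩ being opposite.
Only those with ⟨ν, α⟩ > 0 carry a string: otherwise the natural floor in `stringSum` is 0 and the
sum is empty. -/
theorem one_sub_mul_stringTerm [Finite ι] [P.IsRootSystem] [P.IsEuclidean] {μ : E}
    (hμ : IsIntegral P μ) (i : ι) (x : E) :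
    (1 - expo (-P.root i) x) * stringTerm P i μ x =
      (1 + expo (-P.root i) x) * rootDeriv P i μ x := by
  classical
  let a : E → ℂ := fun ν => if 0 < ⟪ν, P.root i⟫_ℝ then (⟪ν, P.root i⟫_ℝ : ℂ) * expo ν x else 0
  let b : E → ℂ := fun ν => if ⟪ν, P.root i⟫_ℝ < 0 then (⟪ν, P.root i⟫_ℝ : ℂ) * expo ν x else 0
  have hab : ∀ ν, a ν + b ν = (⟪ν, P.root i⟫_ℝ : ℂ) * expo ν x := by
    intro ν
    rcases lt_trichotomy ⟪ν, P.root i⟫_ℝ 0 with h | h | h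
    · simp [a, b, h, h.not_gt]
    · simp [a, b, h]
    · simp [a, b, h, h.not_gt]
  have hinner : ∀ ν, ⟪P.reflection i ν, P.root i⟫_ℝ = -⟪ν, P.root i⟫_ℝ := fun ν => by
    rw [reflection_eq, inner_sub_left, inner_smul_left, RCLike.conj_to_real, coroot'_mul_inner]
    ring
  have hterm : ∀ ν, IsIntegral P ν →
      (1 - expo (-P.root i) x) * ((⟪ν, P.root i⟫_ℝ : ℂ) * stringSum P i ν x) =
        (1 + expo (-P.root i) x) * (a ν + b (P.reflection i ν)) := by
    intro ν hν
    by_cases hpos : 0 < ⟪ν, P.root i⟫_ℝ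
    · obtain ⟨k, hk⟩ := hν i
      have hk0 : 0 ≤ k := by
        have := (coroot'_pos_iff P i ν).mpr hpos
        rw [hk] at this
        exact_mod_cast this.le
      lift k to ℕ using hk0
      have h := one_sub_mul_stringSum P (by simpa using hk) x
      have ha : a ν = (⟪ν, P.root i⟫_ℝ : ℂ) * expo ν x := if_pos hpos
      have hb : b (P.reflection i ν) = -(⟪ν, P.root i⟫_ℝ : ℂ) * expo (P.reflection i ν) x := by
        simp [b, hinner, hpos]
      rw [ha, hb]
      linear_combination (⟪ν, P.root i⟫_ℝ : ℂ) * h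
    · have hz : ⌊P.coroot' i ν⌋₊ = 0 := by
        refine Nat.floor_of_nonpos ?_
        by_contra! h
        exact hpos ((coroot'_pos_iff P i ν).mp h)
      have ha : a ν = 0 := if_neg hpos
      have hb : b (P.reflection i ν) = 0 := if_neg (by rw [hinner]; linarith)
      rw [ha, hb, stringSum, hz]
      simp
  have hb : ∑ w : P.weylGroup, b (P.reflection i (w • μ)) = ∑ w : P.weylGroup, b (w • μ) :=
    Fintype.sum_equiv (Equiv.mulLeft (RootPairing.weylGroup.ofIdx P i)) _ _ fun w => by
      simp only [Equiv.coe_mulLeft, mul_smul]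
      rfl
  rw [stringTerm, Finset.mul_sum, Finset.sum_congr rfl fun w _ => hterm _ (hμ.weyl_smul w),
    ← Finset.mul_sum, Finset.sum_add_distrib, hb, ← Finset.sum_add_distrib, rootDeriv]
  simp only [hab]

theorem stringSum_weyl_smul [P.IsEuclidean] (w : P.weylGroup) (i : ι) (μ x : E) :
    stringSum P (P.weylGroupToPerm w i) (w • μ) x =
      ∑ l ∈ Finset.range ⌊P.coroot' i μ⌋₊,
        (expo (w • (μ - l • P.root i)) x + expo (w • (μ - (l + 1) • P.root i)) x) := by
  simp only [stringSum, coroot'_weyl_smul, smul_sub, smul_nsmul_eq, P.weylGroup_apply_root]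

/-- For each w the roots are reindexed by α ↦ wα. This needs the sum over all of R and the
W-invariance of g. -/
theorem sum_stringTerm [Fintype ι] [P.IsRootSystem] [P.IsEuclidean] {g : ι → ℝ}
    (hgW : ∀ (w : P.weylGroup) (i : ι), g (P.weylGroupToPerm w i) = g i) (μ x : E) :
    ∑ i, (g i : ℂ) * stringTerm P i μ x =
      ∑ i, (g i : ℂ) * (⟪μ, P.root i⟫_ℝ : ℂ) * ∑ l ∈ Finset.range ⌊P.coroot' i μ⌋₊,
        (weylSum P (μ - l • P.root i) x + weylSum P (μ - (l + 1) • P.root i) x) := by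
  simp only [stringTerm, Finset.mul_sum]
  rw [Finset.sum_comm]
  have h : ∀ w : P.weylGroup,
      ∑ i, (g i : ℂ) * ((⟪w • μ, P.root i⟫_ℝ : ℂ) * stringSum P i (w • μ) x) =
        ∑ i, (g i : ℂ) * (⟪μ, P.root i⟫_ℝ : ℂ) * ∑ l ∈ Finset.range ⌊P.coroot' i μ⌋₊,
          (expo (w • (μ - l • P.root i)) x + expo (w • (μ - (l + 1) • P.root i)) x) := by
    intro w
    rw [← Equiv.sum_comp (P.weylGroupToPerm w)]
    refine Finset.sum_congr rfl fun i _ => ?_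
    rw [hgW, inner_weyl_smul_root, stringSum_weyl_smul, mul_assoc]
  rw [Finset.sum_congr rfl fun w _ => h w, Finset.sum_comm]
  refine Finset.sum_congr rfl fun i _ => ?_
  rw [← Finset.mul_sum, Finset.sum_comm, Finset.mul_sum]
  refine Finset.sum_congr rfl fun l _ => ?_
  rw [Finset.sum_add_distrib]
  rfl

/-- Interior points of the string occur twice. The end points μ and r_α μ occur once each, with the
same orbit sum; hence the common factor 2. Negative roots have empty strings. -/
theorem sum_stringTerm_of_isDominant [Fintype ι] [P.IsRootSystem] [P.IsEuclidean] {g : ι → ℝ}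
    (hgW : ∀ (w : P.weylGroup) (i : ι), g (P.weylGroupToPerm w i) = g i)
    {Φ : Finset ι} (hΦ : IsPositiveSystem P Φ) {μ : E} (hμ : IsDominant P Φ μ) (x : E) :
    ∑ i, (g i : ℂ) * stringTerm P i μ x =
      2 * ∑ i ∈ Φ, (g i : ℂ) * (⟪μ, P.root i⟫_ℝ : ℂ) * (weylSum P μ x +
        ∑ l ∈ Finset.Ico 1 ⌊P.coroot' i μ⌋₊, weylSum P (μ - l • P.root i) x) := by
  classical
  rw [sum_stringTerm P hgW, Finset.mul_sum]
  symm
  refine Finset.sum_subset_zero_on_sdiff (Finset.subset_univ Φ) ?_ ?_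
  · intro i hi
    have hi' : i ∉ Φ := by simpa using hi
    have : ⌊P.coroot' i μ⌋₊ = 0 := by
      refine Nat.floor_of_nonpos ?_
      by_contra! hpos
      rw [coroot'_pos_iff] at hpos
      obtain ⟨j, hj, hji⟩ := (hΦ.mem_or_neg_mem i).resolve_left hi'
      have := hμ.inner_nonneg hj
      rw [hji, inner_neg_right] at this
      linarith
    rw [this]
    simp
  · intro i hi
    obtain ⟨k, hk⟩ := hμ i hi
    rw [hk, Nat.floor_natCast]
    -- For k = 0 the string is empty, and the term with M_μ is killed by ⟨μ, α⟩ = 0.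
    rcases k with _ | k
    · have h := coroot'_mul_inner P i μ
      rw [hk] at h
      have : ⟪μ, P.root i⟫_ℝ = 0 := by
        push_cast at h
        linarith
      simp [this]
    · have hlast : weylSum P (μ - (k + 1) • P.root i) x = weylSum P μ x := by
        rw [← weylSum_smul P (RootPairing.weylGroup.ofIdx P i) μ, ofIdx_smul_eq, hk,
          Nat.cast_smul_eq_nsmul]
      rw [Finset.sum_add_distrib, Finset.sum_range_succ', Finset.sum_range_succ, hlast,
        Finset.sum_Ico_eq_sum_range]
      simp only [Nat.add_sub_cancel, zero_smul, sub_zero, add_comm 1]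
      ring

end Operator

end HeckmanOpdam

namespace HeckmanOpdam

/-! ### The matrix elements d_{μν} and triangularity -/

noncomputable section MatrixElements

variable {ι : Type*} {E : Type*} [NormedAddCommGroup E] [InnerProductSpace ℝ E]
  {N : Type*} [AddCommGroup N] [Module ℝ N] {P : RootPairing ι ℝ E N} {Φ : Finset ι}

theorem sub_nsmul_mem_orbit_of_sub {μ ν : E} {i : ι} {k l : ℕ} (hk : P.coroot' i μ = k)
    (hlk : l ≤ k) (h : μ - l • P.root i ∈ MulAction.orbit P.weylGroup ν) :
    μ - (k - l) • P.root i ∈ MulAction.orbit P.weylGroup ν := by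
  have := MulAction.mem_orbit_of_mem_orbit (RootPairing.weylGroup.ofIdx P i) h
  rw [ofIdx_smul_eq, map_sub, map_nsmul, coroot'_root_self, hk] at this
  convert this using 1
  rw [← Nat.cast_smul_eq_nsmul ℝ, ← Nat.cast_smul_eq_nsmul ℝ, Nat.cast_sub hlk]
  module

theorem mem_rootString {μ ν : E} {i : ι} {k : ℕ} (hk : P.coroot' i μ = k) :
    i ∈ rootString P Φ μ ν ↔ i ∈ Φ ∧ ∃ l, 1 ≤ l ∧ 2 * l ≤ k ∧
      μ - l • P.root i ∈ MulAction.orbit P.weylGroup ν := by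
  classical
  have hfl : ⌊(k : ℝ) / 2⌋₊ = k / 2 := by
    have := Nat.floor_div_natCast (k : ℝ) 2
    rw [Nat.floor_natCast] at this
    exact_mod_cast this
  rw [rootString, Finset.mem_filter, hk, hfl]
  refine and_congr_right fun _ => exists_congr fun l => and_congr_right fun _ =>
    and_congr_left fun _ => ?_
  lia

variable [P.IsEuclidean]

theorem eq_or_eq_sub_of_mem_orbit {μ ν : E} {i : ι} {k l l' : ℕ} (hk : P.coroot' i μ = k)
    (hlk : l ≤ k) (h : μ - l • P.root i ∈ MulAction.orbit P.weylGroup ν)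
    (h' : μ - l' • P.root i ∈ MulAction.orbit P.weylGroup ν) : l' = l ∨ l' = k - l := by
  obtain ⟨w, hw⟩ := h
  obtain ⟨w', hw'⟩ := h'
  change w • ν = _ at hw
  change w' • ν = _ at hw'
  have h1 := inner_self_sub_nsmul_root hk l
  have h2 := inner_self_sub_nsmul_root hk l'
  rw [← hw, inner_weyl_smul] at h1
  rw [← hw', inner_weyl_smul, h1] at h2
  have h3 : (l : ℝ) * (k - l) = l' * (k - l') :=
    mul_right_cancel₀ (inner_root_self_pos P i).ne' (by linarith)
  have h4 : ((l' : ℝ) - l) * (l' - (k - l)) = 0 := by linear_combination h3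
  rcases mul_eq_zero.mp h4 with h | h
  · exact Or.inl (by exact_mod_cast sub_eq_zero.mp h)
  · right
    rw [sub_eq_zero, ← Nat.cast_sub hlk] at h
    exact_mod_cast h

/-- (μ + r_α μ)/2 is the midpoint μ - (k/2)α of the string, and norms detect whether l = k/2. -/
theorem mult_eq {μ ν : E} {i : ι} {k l : ℕ} (hk : P.coroot' i μ = k)
    (h : μ - l • P.root i ∈ MulAction.orbit P.weylGroup ν) :
    mult P μ ν i = if 2 * l = k then 1 else 2 := by
  classical
  obtain ⟨w, hw⟩ := h
  change w • ν = _ at hw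
  have h1 := inner_self_sub_nsmul_root hk l
  rw [← hw, inner_weyl_smul] at h1
  have h2 : ⟪(1 / 2 : ℝ) • (μ + P.reflection i μ), (1 / 2 : ℝ) • (μ + P.reflection i μ)⟫_ℝ =
      ⟪μ, μ⟫_ℝ - (k : ℝ) ^ 2 / 4 * ⟪P.root i, P.root i⟫_ℝ := by
    have h := coroot'_mul_inner P i μ
    rw [hk] at h
    rw [reflection_eq, hk]
    simp only [inner_add_left, inner_add_right, inner_sub_left, inner_sub_right, inner_smul_left,
      inner_smul_right, RCLike.conj_to_real, real_inner_comm μ (P.root i)]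
    linear_combination (k : ℝ) / 2 * h
  have h3 : ‖ν‖ = ‖(1 / 2 : ℝ) • (μ + P.reflection i μ)‖ ↔ 2 * l = k := by
    rw [← sq_eq_sq₀ (norm_nonneg _) (norm_nonneg _), ← real_inner_self_eq_norm_sq,
      ← real_inner_self_eq_norm_sq, h1, h2]
    have h0 := inner_root_self_pos P i
    constructor
    · intro h
      have h4 : (l : ℝ) * (k - l) = (k : ℝ) ^ 2 / 4 := mul_right_cancel₀ h0.ne' (by linarith)
      have h5 : ((2 * l : ℝ) - k) ^ 2 = 0 := by linear_combination -4 * h4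
      have h6 := sub_eq_zero.mp (pow_eq_zero_iff two_ne_zero |>.mp h5)
      exact_mod_cast h6
    · rintro rfl
      push_cast
      ring
  rw [mult]
  simp only [h3]

open Classical in
-- If the orbit meets the interior of the string, it does so exactly in l and k - l, which coincide
-- when 2l = k. So the bound l ≤ k/2 in `rootString` and the factor `mult` together count every
-- interior point once.
theorem card_filter_mem_orbit {μ : E} (ν : E) {i : ι} (hi : i ∈ Φ) {k : ℕ}
    (hk : P.coroot' i μ = k) :
    ((Finset.Ico 1 k).filter fun l =>
      μ - l • P.root i ∈ MulAction.orbit P.weylGroup ν).card =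
      if i ∈ rootString P Φ μ ν then mult P μ ν i else 0 := by
  split_ifs with h
  · obtain ⟨-, l, hl1, hlk, hl⟩ := (mem_rootString hk).mp h
    have hset : (Finset.Ico 1 k).filter (fun l =>
        μ - l • P.root i ∈ MulAction.orbit P.weylGroup ν) = {l, k - l} := by
      ext l'
      simp only [Finset.mem_filter, Finset.mem_Ico, Finset.mem_insert, Finset.mem_singleton]
      constructor
      · rintro ⟨-, h'⟩
        exact eq_or_eq_sub_of_mem_orbit hk (by lia) hl h'
      · rintro (rfl | rfl)
        · exact ⟨by lia, hl⟩
        · exact ⟨by lia, sub_nsmul_mem_orbit_of_sub hk (by lia) hl⟩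
    rw [hset, mult_eq hk hl]
    split_ifs with h2
    · rw [show k - l = l by lia]
      simp
    · rw [Finset.card_pair (by lia)]
      norm_num
  · rw [Finset.filter_eq_empty_iff.mpr]
    · simp
    · intro l hl hmem
      rw [Finset.mem_Ico] at hl
      rw [mem_rootString hk] at h
      push Not at h
      by_cases h2 : 2 * l ≤ k
      · exact h hi l hl.1 h2 hmem
      · exact h hi (k - l) (by lia) (by lia) (sub_nsmul_mem_orbit_of_sub hk (by lia) hmem)

theorem preceq_and_ne_of_dcoef_ne_zero [Finite ι] [P.IsCrystallographic]
    (hΦ : IsPositiveSystem P Φ) {g : ι → ℝ} {μ ν : E} (hμ : IsDominant P Φ μ)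
    (h : dcoef P Φ g μ ν ≠ 0) : Preceq P Φ ν μ ∧ ν ≠ μ := by
  have hne : (rootString P Φ μ ν).Nonempty := by
    by_contra hemp
    rw [Finset.not_nonempty_iff_eq_empty] at hemp
    exact h (by simp [dcoef, hemp])
  obtain ⟨i, hi⟩ := hne
  classical
  have hiΦ : i ∈ Φ := (Finset.mem_filter.mp hi).1
  obtain ⟨k, hk⟩ := hμ i hiΦ
  obtain ⟨-, l, hl1, hlk, hl⟩ := (mem_rootString hk).mp hi
  exact ⟨hμ.preceq_of_sub_nsmul_mem_orbit hΦ hk (by lia) hl,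
    ne_of_sub_nsmul_mem_orbit hk (by lia) (by lia) hl⟩

open Classical in
-- Distinct dominant weights have disjoint orbits, so exactly one term survives.
theorem weylSum_eq_sum_ite [Finite ι] [P.IsRootSystem] [P.IsCrystallographic]
    (hΦ : IsPositiveSystem P Φ) {S : Finset E} (hS : ∀ ν ∈ S, IsDominant P Φ ν) {κ : E}
    (hκ : ∃ ν ∈ S, κ ∈ MulAction.orbit P.weylGroup ν) (x : E) :
    weylSum P κ x =
      ∑ ν ∈ S, if κ ∈ MulAction.orbit P.weylGroup ν then weylSum P ν x else 0 := by
  obtain ⟨ν, hν, hmem⟩ := hκ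
  rw [Finset.sum_eq_single_of_mem ν hν, if_pos hmem]
  · obtain ⟨w, rfl⟩ := hmem
    exact weylSum_smul P w ν x
  · intro ν' hν' hne
    rw [if_neg]
    intro hmem'
    refine hne ((hS ν' hν').eq_of_mem_orbit hΦ (hS ν hν) ?_)
    rw [← MulAction.orbit_eq_iff] at hmem hmem' ⊢
    rw [← hmem', hmem]

variable (P) in
/-- The result of applying the Heckman–Opdam Laplacian to the sum of
`e^{wμ}` over the Weyl group, up to sign. -/
def hypergeometricOp [Fintype ι] [P.IsRootSystem] (g : ι → ℝ) (μ x : E) : ℂ :=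
  (⟪μ, μ⟫_ℝ : ℂ) * weylSum P μ x + (1 / 2) * ∑ i, (g i : ℂ) * stringTerm P i μ x

/-- Interior string points are grouped by the dominant weights of their orbits. Passing from M_ν to
m_ν produces the quotient |W_ν|/|W_μ| of d_{μν}; the end points supply the linear part of ε_μ. -/
theorem hypergeometricOp_eq [Fintype ι] [P.IsRootSystem] [P.IsCrystallographic] {g : ι → ℝ}
    (hgW : ∀ (w : P.weylGroup) (i : ι), g (P.weylGroupToPerm w i) = g i)
    (hΦ : IsPositiveSystem P Φ) {lam : E} {S : Finset E}
    (hS : ∀ ν, ν ∈ S ↔ ν ∈ dominantBelow P Φ lam) {μ : E} (hμS : μ ∈ S) (x : E) :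
    hypergeometricOp P g μ x = stabOrder P μ * ((eps P Φ g μ : ℂ) * monomial P μ x +
      ∑ ν ∈ S, (dcoef P Φ g μ ν : ℂ) * monomial P ν x) := by
  classical
  have hμ := ((hS μ).mp hμS).1
  have hS' : ∀ ν ∈ S, IsDominant P Φ ν := fun ν hν => ((hS ν).mp hν).1
  have hs0 : (stabOrder P μ : ℂ) ≠ 0 := Nat.cast_ne_zero.mpr (stabOrder_ne_zero P μ)
  have hgroup : ∀ i ∈ Φ, ∑ l ∈ Finset.Ico 1 ⌊P.coroot' i μ⌋₊, weylSum P (μ - l • P.root i) x =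
      ∑ ν ∈ S, ((if i ∈ rootString P Φ μ ν then mult P μ ν i else 0 : ℝ) : ℂ) *
        weylSum P ν x := by
    intro i hi
    obtain ⟨k, hk⟩ := hμ i hi
    have hfl : ⌊P.coroot' i μ⌋₊ = k := by rw [hk, Nat.floor_natCast]
    rw [hfl]
    have h1 : ∀ l ∈ Finset.Ico 1 k, weylSum P (μ - l • P.root i) x = ∑ ν ∈ S,
        if μ - l • P.root i ∈ MulAction.orbit P.weylGroup ν then weylSum P ν x else 0 := by
      intro l hl
      rw [Finset.mem_Ico] at hl
      refine weylSum_eq_sum_ite hΦ hS' ?_ x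
      obtain ⟨w, hw⟩ := exists_dominant_mem_orbit hΦ
        ((hμ.isIntegral hΦ).sub ((isIntegral_root P i).nsmul l))
      have hmem : μ - l • P.root i ∈ MulAction.orbit P.weylGroup (w • (μ - l • P.root i)) :=
        ⟨w⁻¹, inv_smul_smul w _⟩
      refine ⟨_, (hS _).mpr ⟨hw, ?_⟩, hmem⟩
      exact (hμ.preceq_of_sub_nsmul_mem_orbit hΦ hk hl.2.le hmem).trans ((hS μ).mp hμS).2
    rw [Finset.sum_congr rfl h1, Finset.sum_comm]
    refine Finset.sum_congr rfl fun ν _ => ?_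
    rw [← card_filter_mem_orbit ν hi hk, ← Finset.sum_filter, Finset.sum_const, nsmul_eq_mul]
    push_cast
    rfl
  rw [hypergeometricOp, sum_stringTerm_of_isDominant P hgW hΦ hμ]
  have h2 : ∑ i ∈ Φ, (g i : ℂ) * (⟪μ, P.root i⟫_ℝ : ℂ) * (weylSum P μ x +
        ∑ l ∈ Finset.Ico 1 ⌊P.coroot' i μ⌋₊, weylSum P (μ - l • P.root i) x) =
      ((∑ i ∈ Φ, g i * ⟪μ, P.root i⟫_ℝ : ℝ) : ℂ) * weylSum P μ x +
        ∑ ν ∈ S, ((∑ i ∈ rootString P Φ μ ν, g i * ⟪μ, P.root i⟫_ℝ * mult P μ ν i : ℝ) : ℂ) *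
          weylSum P ν x := by
    have h3 : ∀ ν, ((∑ i ∈ rootString P Φ μ ν, g i * ⟪μ, P.root i⟫_ℝ * mult P μ ν i : ℝ) : ℂ) =
        ∑ i ∈ Φ, (g i : ℂ) * (⟪μ, P.root i⟫_ℝ : ℂ) *
          ((if i ∈ rootString P Φ μ ν then mult P μ ν i else 0 : ℝ) : ℂ) := by
      intro ν
      have hsub : rootString P Φ μ ν ⊆ Φ := Finset.filter_subset _ _
      rw [Complex.ofReal_sum]
      refine Finset.sum_subset_zero_on_sdiff hsub ?_ ?_
      · intro i hi
        rw [if_neg (Finset.mem_sdiff.mp hi).2]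
        simp
      · intro i hi
        rw [if_pos hi]
        push_cast
        ring
    simp only [h3, mul_add, Finset.sum_add_distrib]
    congr 1
    · push_cast
      rw [Finset.sum_mul]
    · simp only [Finset.sum_mul]
      rw [Finset.sum_comm]
      refine Finset.sum_congr rfl fun i hi => ?_
      rw [hgroup i hi, Finset.mul_sum]
      simp only [mul_assoc]
  rw [h2, eps_eq]
  simp only [dcoef, weylSum_eq]
  have h4 : ∀ ν ∈ S, (stabOrder P μ : ℂ) * ((stabOrder P ν : ℂ) / (stabOrder P μ : ℂ) *
      (∑ i ∈ rootString P Φ μ ν, (g i : ℂ) * (⟪μ, P.root i⟫_ℝ : ℂ) * (mult P μ ν i : ℂ)) *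
        monomial P ν x) = (∑ i ∈ rootString P Φ μ ν, (g i : ℂ) * (⟪μ, P.root i⟫_ℝ : ℂ) *
          (mult P μ ν i : ℂ)) * ((stabOrder P ν : ℂ) * monomial P ν x) := by
    intro ν _
    field_simp
  push_cast
  rw [mul_add (stabOrder P μ : ℂ), Finset.mul_sum S _ (stabOrder P μ : ℂ),
    Finset.sum_congr rfl h4]
  ring

end MatrixElements

end HeckmanOpdam

namespace HeckmanOpdam

open MeasureTheory
open scoped Pointwise

/-! ### Periodicity with respect to 2π𝒬^∨ -/

section Periodic

variable {ι : Type*} {E : Type*} [NormedAddCommGroup E] [InnerProductSpace ℝ E]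
  {N : Type*} [AddCommGroup N] [Module ℝ N] (P : RootPairing ι ℝ E N)

/-- Functions on `E` that are periodic with respect to `2π 𝒬^∨`. -/
def IsTorusPeriodic {F : Type*} (f : E → F) : Prop :=
  ∀ y ∈ torusLattice P, ∀ x, f (y + x) = f x

variable {P}

theorem expo_eq_one_of_mem_torusLattice [P.IsEuclidean] {μ : E} (hμ : IsIntegral P μ) {y : E}
    (hy : y ∈ torusLattice P) : expo μ y = 1 := by
  have h : ∃ k : ℤ, ⟪μ, y⟫_ℝ = k * (2 * Real.pi) := by
    induction hy using Submodule.span_induction with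
    | mem y hy =>
      obtain ⟨j, rfl⟩ := hy
      obtain ⟨k, hk⟩ := hμ j
      refine ⟨k, ?_⟩
      rw [← hk, RootPairing.IsEuclidean.coroot'_eq (P := P)]
      simp only [inner_smul_right]
      ring
    | zero => exact ⟨0, by simp⟩
    | add y z _ _ hy hz =>
      obtain ⟨k, hk⟩ := hy
      obtain ⟨l, hl⟩ := hz
      exact ⟨k + l, by rw [inner_add_right, hk, hl]; push_cast; ring⟩
    | smul a y _ hy =>
      obtain ⟨k, hk⟩ := hy
      refine ⟨a * k, ?_⟩
      rw [← Int.cast_smul_eq_zsmul ℝ a y, inner_smul_right, hk]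
      push_cast
      ring
  obtain ⟨k, hk⟩ := h
  rw [expo, hk, Complex.exp_eq_one_iff]
  exact ⟨k, by push_cast; ring⟩

theorem expo_add_right (μ x y : E) : expo μ (x + y) = expo μ x * expo μ y := by
  simp only [expo, inner_add_right, Complex.ofReal_add, mul_add, Complex.exp_add]

theorem isTorusPeriodic_expo [P.IsEuclidean] {μ : E} (hμ : IsIntegral P μ) :
    IsTorusPeriodic P (expo μ) := fun y hy x => by
  rw [expo_add_right, expo_eq_one_of_mem_torusLattice hμ hy, one_mul]

theorem isTorusPeriodic_weylSum [Finite ι] [P.IsRootSystem] [P.IsEuclidean] {μ : E}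
    (hμ : IsIntegral P μ) : IsTorusPeriodic P (weylSum P μ) := fun y hy x =>
  Finset.sum_congr rfl fun w _ => isTorusPeriodic_expo (hμ.weyl_smul w) y hy x

theorem continuous_expo (μ : E) : Continuous (expo μ) := by
  unfold expo
  fun_prop

theorem continuous_weylSum [Finite ι] [P.IsRootSystem] (μ : E) : Continuous (weylSum P μ) :=
  continuous_finsetSum _ fun _ _ => continuous_expo _

theorem continuous_monomial [Finite ι] [P.IsRootSystem] (μ : E) :
    Continuous (monomial P μ) := by
  rw [funext (monomial_eq P μ)]
  exact continuous_const.mul (continuous_weylSum μ)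

theorem isTorusPeriodic_monomial [Finite ι] [P.IsRootSystem] [P.IsEuclidean] {μ : E}
    (hμ : IsIntegral P μ) : IsTorusPeriodic P (monomial P μ) := fun y hy x => by
  rw [monomial_eq, monomial_eq, isTorusPeriodic_weylSum hμ y hy x]

theorem continuous_stringTerm [Finite ι] [P.IsRootSystem] (i : ι) (μ : E) :
    Continuous (stringTerm P i μ) :=
  continuous_finsetSum _ fun _ _ => continuous_const.mul <|
    continuous_finsetSum _ fun _ _ => (continuous_expo _).add (continuous_expo _)

end Periodic

/-! ### Integration over the torus -/

section TorusIntegral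

variable {ι : Type*} [Fintype ι] {E : Type*} [NormedAddCommGroup E] [InnerProductSpace ℝ E]
  [FiniteDimensional ℝ E] {N : Type*} [AddCommGroup N] [Module ℝ N]
  (P : RootPairing ι ℝ E N) [P.IsRootSystem] [P.IsCrystallographic] [P.IsEuclidean]

theorem isBounded_torusDomain : Bornology.IsBounded (torusDomain P) :=
  ZSpan.fundamentalDomain_isBounded _

variable [MeasurableSpace E] [BorelSpace E]

theorem measurableSet_torusDomain : MeasurableSet (torusDomain P) :=
  ZSpan.fundamentalDomain_measurableSet _

theorem isAddFundamentalDomain_torusDomain :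
    IsAddFundamentalDomain (torusLattice P) (torusDomain P) (volume : Measure E) :=
  ZLattice.isAddFundamentalDomain _ _

theorem integrableOn_torusDomain {F : Type*} [NormedAddCommGroup F] {f : E → F}
    (hf : Continuous f) : IntegrableOn f (torusDomain P) :=
  (hf.continuousOn.integrableOn_compact (isBounded_torusDomain P).isCompact_closure).mono_set
    subset_closure

variable {P}

/-- A translate of a fundamental domain is again a fundamental domain. -/
theorem IsTorusPeriodic.integral_comp_add {f : E → ℂ} (hf : IsTorusPeriodic P f) (a : E) :
    ∫ x in torusDomain P, f (x + a) = ∫ x in torusDomain P, f x := by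
  have hD := isAddFundamentalDomain_torusDomain P
  have hD' : IsAddFundamentalDomain (torusLattice P) (a +ᵥ torusDomain P) (volume : Measure E) :=
    hD.vadd_of_comm a
  have : VAddInvariantMeasure (torusLattice P) E volume :=
    inferInstanceAs <| VAddInvariantMeasure (torusLattice P).toAddSubgroup E volume
  have h1 := (measurePreserving_vadd a (volume : Measure E)).setIntegral_image_emb
    (measurableEmbedding_const_vadd a) f (torusDomain P)
  have h2 := hD'.setIntegral_eq hD (f := f) fun y x => hf y y.2 x
  rw [← h2]
  change _ = ∫ x in (fun x => a +ᵥ x) '' torusDomain P, f x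
  rw [h1]
  simp only [vadd_eq_add, add_comm]

/-- The integral of f(x + tv) does not depend on t. It may be differentiated under the integral
sign, since f' is continuous and periodic, hence bounded. -/
theorem IsTorusPeriodic.integral_deriv_eq_zero {f f' : E → ℂ} (hf : IsTorusPeriodic P f)
    (hfc : Continuous f) (hf'c : Continuous f') (v : E)
    (hderiv : ∀ x, HasDerivAt (fun t : ℝ => f (x + t • v)) (f' x) 0) :
    ∫ x in torusDomain P, f' x = 0 := by
  have hf' : ∀ z w, w ∈ torusLattice P → f' (z + w) = f' z := by
    intro z w hw
    have h := hderiv (z + w)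
    have heq : (fun t : ℝ => f (z + w + t • v)) = fun t : ℝ => f (z + t • v) := by
      funext t
      rw [add_right_comm, add_comm, hf w hw]
    rw [heq] at h
    exact h.unique (hderiv z)
  obtain ⟨C, hC⟩ := (IsZLattice.isCompact_range_of_periodic (torusLattice P) f' hf'c
    hf').isBounded.exists_norm_le
  have hderiv' : ∀ x (t : ℝ), HasDerivAt (fun t : ℝ => f (x + t • v)) (f' (x + t • v)) t := by
    intro x t
    have h := hderiv (x + t • v)
    rw [← sub_self t] at h
    have h2 := h.comp_sub_const t t
    have heq : (fun s : ℝ => f (x + s • v)) = fun s => f (x + t • v + (s - t) • v) := by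
      funext s
      congr 1
      module
    rwa [heq]
  have h := hasDerivAt_integral_of_dominated_loc_of_deriv_le
    (μ := (volume : Measure E).restrict (torusDomain P)) (F := fun (t : ℝ) x => f (x + t • v))
    (F' := fun t x => f' (x + t • v)) (x₀ := 0) (bound := fun _ => C) Filter.univ_mem
    (.of_forall fun t => (by fun_prop : Continuous fun x => f (x + t • v)).aestronglyMeasurable)
    (integrableOn_torusDomain P (by fun_prop))
    (by fun_prop : Continuous fun x => f' (x + (0 : ℝ) • v)).aestronglyMeasurable
    (.of_forall fun x t _ => hC _ ⟨_, rfl⟩) (integrableOn_torusDomain P continuous_const)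
    (.of_forall fun x t _ => hderiv' x t)
  have h2 := h.2
  simp only [hf.integral_comp_add, zero_smul, add_zero] at h2
  exact h2.unique (hasDerivAt_const _ _)

theorem volume_inner_eq {α : E} (hα : α ≠ 0) (c : ℝ) :
    (volume : Measure E) {x | ⟪α, x⟫_ℝ = c} = 0 := by
  have hne : ⟪α, α⟫_ℝ ≠ 0 := inner_self_ne_zero.mpr hα
  have h0 : (volume : Measure E) (LinearMap.ker (innerSL ℝ α).toLinearMap : Submodule ℝ E) = 0 := by
    refine Measure.addHaar_submodule _ _ fun h => hne ?_
    have : α ∈ LinearMap.ker (innerSL ℝ α).toLinearMap := h ▸ Submodule.mem_top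
    simpa using this
  rw [← measure_preimage_add_right (volume : Measure E) (-((c / ⟪α, α⟫_ℝ) • α))] at h0
  convert h0 using 2
  ext x
  have : c / ⟪α, α⟫_ℝ * ⟪α, α⟫_ℝ = c := div_mul_cancel₀ _ hne
  simp only [Set.mem_ofPred_eq, Set.mem_preimage, SetLike.mem_coe, LinearMap.mem_ker,
    ContinuousLinearMap.coe_coe, innerSL_apply_apply, inner_add_right, inner_neg_right,
    inner_smul_right, this]
  rw [← sub_eq_add_neg, sub_eq_zero]

/-- The exceptional set is a countable union of affine hyperplanes. -/
theorem ae_expo_ne_one {α : E} (hα : α ≠ 0) :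
    ∀ᵐ x ∂(volume : Measure E), expo α x ≠ 1 := by
  have h : ∀ᵐ x ∂(volume : Measure E), ∀ k : ℤ, ⟪α, x⟫_ℝ ≠ k * (2 * Real.pi) :=
    ae_all_iff.mpr fun k => by
      rw [ae_iff]
      simpa using volume_inner_eq hα (k * (2 * Real.pi))
  filter_upwards [h] with x hx h1
  rw [expo, Complex.exp_eq_one_iff] at h1
  obtain ⟨k, hk⟩ := h1
  refine hx k ?_
  have h2 : (⟪α, x⟫_ℝ : ℂ) = k * (2 * Real.pi) :=
    mul_left_cancel₀ Complex.I_ne_zero (by rw [hk]; ring)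
  exact_mod_cast h2

end TorusIntegral

end HeckmanOpdam

namespace HeckmanOpdam

open MeasureTheory Filter
open scoped Topology

/-! ### The regularized weight and its derivative -/

noncomputable section RegularizedWeight

variable {ι : Type*} [Fintype ι] {E : Type*} [NormedAddCommGroup E] [InnerProductSpace ℝ E]
  {N : Type*} [AddCommGroup N] [Module ℝ N] (P : RootPairing ι ℝ E N)

omit [Fintype ι] in
theorem norm_one_sub_expo_sq (i : ι) (x : E) :
    ‖1 - expo (P.root i) x‖ ^ 2 = 2 - 2 * Real.cos ⟪P.root i, x⟫_ℝ := by
  rw [← Complex.normSq_eq_norm_sq, expo, mul_comm, Complex.exp_mul_I, Complex.normSq_apply,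
    ← Complex.ofReal_cos, ← Complex.ofReal_sin]
  simp [Complex.cos_ofReal_re, Complex.sin_ofReal_re]
  linear_combination Real.sin_sq_add_cos_sq ⟪P.root i, x⟫_ℝ

/-- The weight function with `|1 - e^α|²` replaced by `|1 - e^α|² + δ`. -/
def regWeight (g : ι → ℝ) (δ : ℝ) (x : E) : ℝ :=
  ∏ i, (‖1 - expo (P.root i) x‖ ^ 2 + δ) ^ (g i / 2)

theorem regWeight_zero (g : ι → ℝ) (x : E) : regWeight P g 0 x = weight P g x := by
  refine Finset.prod_congr rfl fun i _ => ?_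
  rw [add_zero, ← Real.rpow_natCast, ← Real.rpow_mul (norm_nonneg _)]
  congr 1
  push_cast
  ring

variable {P}

theorem continuous_regWeight {g : ι → ℝ} (hg : ∀ i, 0 ≤ g i) (δ : ℝ) :
    Continuous (regWeight P g δ) := by
  refine continuous_finsetProd _ fun i _ => Continuous.rpow_const ?_ fun x =>
    Or.inr (div_nonneg (hg i) two_pos.le)
  have := continuous_expo (P.root i)
  fun_prop

theorem continuous_weight {g : ι → ℝ} (hg : ∀ i, 0 ≤ g i) : Continuous (weight P g) := by
  rw [← funext (regWeight_zero P g)]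
  exact continuous_regWeight hg 0

theorem regWeight_nonneg (g : ι → ℝ) {δ : ℝ} (hδ : 0 ≤ δ) (x : E) : 0 ≤ regWeight P g δ x :=
  Finset.prod_nonneg fun _ _ => Real.rpow_nonneg (by positivity) _

theorem regWeight_le {g : ι → ℝ} (hg : ∀ i, 0 ≤ g i) {δ ε : ℝ} (hδ : 0 ≤ δ) (h : δ ≤ ε) (x : E) :
    regWeight P g δ x ≤ regWeight P g ε x :=
  Finset.prod_le_prod (fun _ _ => Real.rpow_nonneg (by positivity) _) fun i _ =>
    Real.rpow_le_rpow (by positivity) (by linarith) (div_nonneg (hg i) two_pos.le)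

theorem tendsto_regWeight {g : ι → ℝ} (hg : ∀ i, 0 ≤ g i) (x : E) :
    Tendsto (fun δ => regWeight P g δ x) (𝓝 0) (𝓝 (weight P g x)) := by
  rw [← regWeight_zero]
  have : Continuous fun δ => regWeight P g δ x :=
    continuous_finsetProd _ fun i _ => Continuous.rpow_const (by fun_prop) fun x =>
      Or.inr (div_nonneg (hg i) two_pos.le)
  exact this.tendsto 0

theorem isTorusPeriodic_regWeight [P.IsCrystallographic] [P.IsEuclidean] (g : ι → ℝ) (δ : ℝ) :
    IsTorusPeriodic P (regWeight P g δ) := fun y hy x =>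
  Finset.prod_congr rfl fun i _ => by rw [isTorusPeriodic_expo (isIntegral_root P i) y hy x]

theorem weight_pos {g : ι → ℝ} {x : E} (hx : ∀ i, expo (P.root i) x ≠ 1) : 0 < weight P g x :=
  Finset.prod_pos fun i _ => Real.rpow_pos_of_pos
    (norm_pos_iff.mpr (sub_ne_zero.mpr (hx i).symm)) _

/-- For δ > 0 every factor is positive, so the logarithmic derivative exists even on the walls e^α =
1. -/
theorem hasDerivAt_regWeight (g : ι → ℝ) {δ : ℝ} (hδ : 0 < δ) (v x : E) :
    HasDerivAt (fun t : ℝ => regWeight P g δ (x + t • v))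
      (regWeight P g δ x * ∑ i, g i * (Real.sin ⟪P.root i, x⟫_ℝ * ⟪v, P.root i⟫_ℝ) /
        (‖1 - expo (P.root i) x‖ ^ 2 + δ)) 0 := by
  have hexp : ∀ y, regWeight P g δ y =
      Real.exp (∑ i, Real.log (2 - 2 * Real.cos ⟪P.root i, y⟫_ℝ + δ) * (g i / 2)) := by
    intro y
    rw [Real.exp_sum]
    refine Finset.prod_congr rfl fun i _ => ?_
    rw [← norm_one_sub_expo_sq, Real.rpow_def_of_pos (by positivity)]
  have hpos : ∀ i, 0 < 2 - 2 * Real.cos ⟪P.root i, x⟫_ℝ + δ := fun i => by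
    rw [← norm_one_sub_expo_sq]
    positivity
  have h1 : ∀ i, HasDerivAt
      (fun t : ℝ => 2 - 2 * Real.cos (⟪P.root i, x⟫_ℝ + t * ⟪P.root i, v⟫_ℝ) + δ)
      (2 * Real.sin ⟪P.root i, x⟫_ℝ * ⟪P.root i, v⟫_ℝ) 0 := by
    intro i
    have h := (((((hasDerivAt_id (0 : ℝ)).mul_const ⟪P.root i, v⟫_ℝ).const_add
      ⟪P.root i, x⟫_ℝ).cos.const_mul 2).const_sub 2).add_const δ
    simp only [id, zero_mul, add_zero, one_mul] at h
    exact h.congr_deriv (by ring)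
  have h2 : HasDerivAt (fun t : ℝ => Real.exp (∑ i, Real.log
      (2 - 2 * Real.cos (⟪P.root i, x⟫_ℝ + t * ⟪P.root i, v⟫_ℝ) + δ) * (g i / 2))) _ 0 :=
    (HasDerivAt.fun_sum fun i _ =>
      ((h1 i).log (by simpa using (hpos i).ne')).mul_const (g i / 2)).exp
  simp only [hexp, inner_add_right, inner_smul_right]
  convert h2 using 1
  simp only [zero_mul, add_zero]
  congr 1
  refine Finset.sum_congr rfl fun i _ => ?_
  rw [norm_one_sub_expo_sq, real_inner_comm v]
  ring

theorem hasDerivAt_expo (μ v x : E) :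
    HasDerivAt (fun t : ℝ => expo μ (x + t • v))
      (Complex.I * (⟪μ, v⟫_ℝ : ℂ) * expo μ x) 0 := by
  have h1 : HasDerivAt (fun t : ℝ => ((⟪μ, x⟫_ℝ + t * ⟪μ, v⟫_ℝ : ℝ) : ℂ))
      ((⟪μ, v⟫_ℝ : ℝ) : ℂ) 0 := by
    have h := ((hasDerivAt_id (0 : ℝ)).mul_const ⟪μ, v⟫_ℝ).const_add ⟪μ, x⟫_ℝ
    rw [one_mul] at h
    exact h.ofReal_comp
  have h2 := (h1.const_mul Complex.I).cexp
  simp only [expo, inner_add_right, inner_smul_right]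
  convert h2 using 1
  simp only [zero_mul, add_zero]
  ring

/-- With z = e^α one has |1 - z|² = (1 - z)(1 - z⁻¹) and (1 - z)(1 + z⁻¹) = z⁻¹ - z, a multiple of
the sine. The factor |1 - z|² cancels, up to δ, the denominator in the derivative of the weight. -/
theorem sin_mul_rootDeriv [P.IsRootSystem] [P.IsEuclidean] {μ : E} (hμ : IsIntegral P μ)
    (i : ι) (x : E) :
    (Real.sin ⟪P.root i, x⟫_ℝ : ℂ) * rootDeriv P i μ x =
      Complex.I * ((1 / 2) * ((‖1 - expo (P.root i) x‖ ^ 2 : ℝ) : ℂ) * stringTerm P i μ x) := by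
  have h := one_sub_mul_stringTerm P hμ i x
  have hz := expo_neg_mul (P.root i) x
  have hnorm : ((‖1 - expo (P.root i) x‖ ^ 2 : ℝ) : ℂ) =
      (1 - expo (P.root i) x) * (1 - expo (-P.root i) x) := by
    rw [← conj_expo, ← Complex.normSq_eq_norm_sq, Complex.normSq_eq_conj_mul_self]
    simp only [map_sub, map_one]
    ring
  have hsin : (Real.sin ⟪P.root i, x⟫_ℝ : ℂ) =
      (expo (-P.root i) x - expo (P.root i) x) * Complex.I / 2 := by
    rw [Complex.ofReal_sin, Complex.sin, expo, expo, inner_neg_left]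
    push_cast
    ring_nf
  rw [hnorm, hsin]
  linear_combination (-(1 - expo (P.root i) x) * Complex.I / 2) * h +
    Complex.I / 2 * rootDeriv P i μ x * hz

end RegularizedWeight

end HeckmanOpdam

namespace HeckmanOpdam

open MeasureTheory Filter
open scoped Topology

/-! ### Symmetry of the Laplacian -/

noncomputable section SelfAdjoint

variable {ι : Type*} [Fintype ι] {E : Type*} [NormedAddCommGroup E] [InnerProductSpace ℝ E]
  {N : Type*} [AddCommGroup N] [Module ℝ N] (P : RootPairing ι ℝ E N) [P.IsRootSystem]

/-- The Hermitian product of the gradients of the sums of `e^{wμ}` and of `e^{wκ}` over the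
Weyl group. -/
def gradInner (μ κ x : E) : ℂ :=
  ∑ w : P.weylGroup, ∑ v : P.weylGroup,
    (⟪w • μ, v • κ⟫_ℝ : ℂ) * (expo (w • μ) x * conj (expo (v • κ) x))

theorem conj_gradInner (μ κ x : E) : conj (gradInner P μ κ x) = gradInner P κ μ x := by
  simp only [gradInner, map_sum, map_mul, Complex.conj_conj, Complex.conj_ofReal]
  rw [Finset.sum_comm]
  refine Finset.sum_congr rfl fun w _ => Finset.sum_congr rfl fun v _ => ?_
  rw [real_inner_comm, mul_comm (expo _ x)]

theorem continuous_gradInner (μ κ : E) : Continuous (gradInner P μ κ) :=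
  continuous_finsetSum _ fun _ _ => continuous_finsetSum _ fun _ _ =>
    continuous_const.mul <| (continuous_expo _).mul <|
      Complex.continuous_conj.comp (continuous_expo _)

variable {P} [FiniteDimensional ℝ E] [P.IsCrystallographic] [P.IsEuclidean]
  [MeasurableSpace E] [BorelSpace E]

/-- The integrated divergence of conj(M_κ) W_δ ∇M_μ, with W_δ the regularized weight. It is computed
one frequency at a time: e^{wμ} conj(M_κ) W_δ is differentiated in the direction wμ, and the results
are summed over w. -/
theorem integral_div_regularized_eq_zero {g : ι → ℝ} (hg : ∀ i, 0 ≤ g i) {δ : ℝ} (hδ : 0 < δ)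
    {μ κ : E} (hμ : IsIntegral P μ) (hκ : IsIntegral P κ) :
    ∫ x in torusDomain P, ((⟪μ, μ⟫_ℝ : ℂ) * weylSum P μ x * conj (weylSum P κ x) -
      gradInner P μ κ x + ∑ i, (1 / 2) * (g i : ℂ) * stringTerm P i μ x * conj (weylSum P κ x) *
        ((‖1 - expo (P.root i) x‖ ^ 2 / (‖1 - expo (P.root i) x‖ ^ 2 + δ) : ℝ) : ℂ)) *
      (regWeight P g δ x : ℂ) = 0 := by
  set r : ι → E → ℝ := fun i x => ‖1 - expo (P.root i) x‖ ^ 2 with hr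
  have hrpos : ∀ i x, 0 < r i x + δ := fun i x => by positivity
  have hcexp : ∀ μ : E, Continuous (expo μ) := continuous_expo
  have hcM : ∀ μ : E, Continuous (weylSum P μ) := continuous_weylSum
  have hcW : Continuous (regWeight P g δ) := continuous_regWeight hg δ
  let df : P.weylGroup → E → ℂ := fun w x =>
    (Complex.I * (⟪w • μ, w • μ⟫_ℝ : ℂ) * expo (w • μ) x * conj (weylSum P κ x) +
      expo (w • μ) x * ∑ v : P.weylGroup,
        Complex.I * (⟪-(v • κ), w • μ⟫_ℝ : ℂ) * expo (-(v • κ)) x) * (regWeight P g δ x : ℂ) +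
    expo (w • μ) x * conj (weylSum P κ x) * ((regWeight P g δ x *
      ∑ i, g i * (Real.sin ⟪P.root i, x⟫_ℝ * ⟪w • μ, P.root i⟫_ℝ) / (r i x + δ) : ℝ) : ℂ)
  have hMconj : ∀ x, conj (weylSum P κ x) = ∑ v : P.weylGroup, expo (-(v • κ)) x := fun x => by
    simp only [weylSum, map_sum, conj_expo]
  have hdf : ∀ w, ∫ x in torusDomain P, df w x = 0 := by
    intro w
    have hper : IsTorusPeriodic P fun x =>
        expo (w • μ) x * conj (weylSum P κ x) * (regWeight P g δ x : ℂ) := fun y hy x => by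
      simp only [isTorusPeriodic_expo (hμ.weyl_smul w) y hy x,
        isTorusPeriodic_weylSum hκ y hy x, isTorusPeriodic_regWeight g δ y hy x]
    refine hper.integral_deriv_eq_zero ?_ ?_ (w • μ) fun x => ?_
    · have := Complex.continuous_conj.comp (hcM κ)
      exact ((hcexp _).mul this).mul (Complex.continuous_ofReal.comp hcW)
    · have h1 := Complex.continuous_conj.comp (hcM κ)
      have h2 : Continuous fun x =>
          ∑ i, g i * (Real.sin ⟪P.root i, x⟫_ℝ * ⟪w • μ, P.root i⟫_ℝ) / (r i x + δ) :=
        continuous_finsetSum _ fun i _ => Continuous.div (by fun_prop)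
          (by have := hcexp (P.root i); fun_prop) fun x => (hrpos i x).ne'
      have h3 : Continuous fun x => ∑ v : P.weylGroup,
          Complex.I * (⟪-(v • κ), w • μ⟫_ℝ : ℂ) * expo (-(v • κ)) x :=
        continuous_finsetSum _ fun v _ => continuous_const.mul (hcexp _)
      exact ((((continuous_const.mul (hcexp _)).mul h1).add ((hcexp _).mul h3)).mul
        (Complex.continuous_ofReal.comp hcW)).add
          (((hcexp _).mul h1).mul (Complex.continuous_ofReal.comp (hcW.mul h2)))
    · have h1 := hasDerivAt_expo (w • μ) (w • μ) x
      have h2 : HasDerivAt (fun t : ℝ => conj (weylSum P κ (x + t • w • μ)))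
          (∑ v : P.weylGroup, Complex.I * (⟪-(v • κ), w • μ⟫_ℝ : ℂ) * expo (-(v • κ)) x) 0 := by
        simp only [hMconj]
        exact HasDerivAt.fun_sum fun v _ => hasDerivAt_expo (-(v • κ)) (w • μ) x
      have h3 := (hasDerivAt_regWeight (P := P) g hδ (w • μ) x).ofReal_comp
      have h4 := (h1.mul h2).mul h3
      simp only [Pi.mul_apply, zero_smul, add_zero] at h4
      exact h4
  have hsum : ∀ x, ∑ w, df w x = Complex.I *
      (((⟪μ, μ⟫_ℝ : ℂ) * weylSum P μ x * conj (weylSum P κ x) -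
      gradInner P μ κ x + ∑ i, (1 / 2) * (g i : ℂ) * stringTerm P i μ x * conj (weylSum P κ x) *
        ((r i x / (r i x + δ) : ℝ) : ℂ)) * (regWeight P g δ x : ℂ)) := by
    intro x
    have h1 : ∑ w : P.weylGroup, Complex.I * (⟪w • μ, w • μ⟫_ℝ : ℂ) * expo (w • μ) x *
        conj (weylSum P κ x) =
          Complex.I * ((⟪μ, μ⟫_ℝ : ℂ) * weylSum P μ x * conj (weylSum P κ x)) := by
      simp only [inner_weyl_smul]
      rw [← Finset.sum_mul, ← Finset.mul_sum]
      change _ * weylSum P μ x * _ = _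
      ring
    have h2 : ∑ w : P.weylGroup, expo (w • μ) x * ∑ v : P.weylGroup,
        Complex.I * (⟪-(v • κ), w • μ⟫_ℝ : ℂ) * expo (-(v • κ)) x =
          -(Complex.I * gradInner P μ κ x) := by
      simp only [gradInner, Finset.mul_sum, conj_expo, ← Finset.sum_neg_distrib]
      refine Finset.sum_congr rfl fun w _ => Finset.sum_congr rfl fun v _ => ?_
      rw [inner_neg_left, real_inner_comm]
      push_cast
      ring
    have h3 : ∑ w : P.weylGroup, expo (w • μ) x * conj (weylSum P κ x) * ((regWeight P g δ x *
        ∑ i, g i * (Real.sin ⟪P.root i, x⟫_ℝ * ⟪w • μ, P.root i⟫_ℝ) / (r i x + δ) : ℝ) : ℂ) =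
        Complex.I * (∑ i, (1 / 2) * (g i : ℂ) * stringTerm P i μ x * conj (weylSum P κ x) *
          ((r i x / (r i x + δ) : ℝ) : ℂ)) * (regWeight P g δ x : ℂ) := by
      have h4 : ∀ i, (1 / 2) * (g i : ℂ) * stringTerm P i μ x * conj (weylSum P κ x) *
          ((r i x / (r i x + δ) : ℝ) : ℂ) * Complex.I * (regWeight P g δ x : ℂ) =
          ∑ w : P.weylGroup, expo (w • μ) x * conj (weylSum P κ x) * (regWeight P g δ x *
            ((g i : ℂ) * (Real.sin ⟪P.root i, x⟫_ℝ * ⟪w • μ, P.root i⟫_ℝ) / (r i x + δ))) := by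
        intro i
        have h5 := sin_mul_rootDeriv hμ i x
        calc _ = Complex.I * ((1 / 2) * ((r i x : ℝ) : ℂ) * stringTerm P i μ x) *
              ((g i : ℂ) * conj (weylSum P κ x) * (regWeight P g δ x : ℂ) / (r i x + δ)) := by
              push_cast
              ring
          _ = _ := by
              rw [hr, ← h5, rootDeriv, Finset.mul_sum, Finset.sum_mul]
              refine Finset.sum_congr rfl fun w _ => ?_
              ring
      rw [mul_comm Complex.I, Finset.sum_mul, Finset.sum_mul, Finset.sum_congr rfl fun i _ => h4 i,
        Finset.sum_comm]
      refine Finset.sum_congr rfl fun w _ => ?_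
      push_cast
      rw [Finset.mul_sum, Finset.mul_sum]
    simp only [df]
    rw [Finset.sum_add_distrib, ← Finset.sum_mul, Finset.sum_add_distrib, h1, h2, h3]
    ring
  have hint : ∀ w, Integrable (df w) ((volume : Measure E).restrict (torusDomain P)) := by
    intro w
    refine integrableOn_torusDomain P ?_
    have h1 := Complex.continuous_conj.comp (hcM κ)
    have h2 : Continuous fun x =>
        ∑ i, g i * (Real.sin ⟪P.root i, x⟫_ℝ * ⟪w • μ, P.root i⟫_ℝ) / (r i x + δ) :=
      continuous_finsetSum _ fun i _ => Continuous.div (by fun_prop)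
        (by have := hcexp (P.root i); fun_prop) fun x => (hrpos i x).ne'
    have h3 : Continuous fun x => ∑ v : P.weylGroup,
        Complex.I * (⟪-(v • κ), w • μ⟫_ℝ : ℂ) * expo (-(v • κ)) x :=
      continuous_finsetSum _ fun v _ => continuous_const.mul (hcexp _)
    exact ((((continuous_const.mul (hcexp _)).mul h1).add ((hcexp _).mul h3)).mul
      (Complex.continuous_ofReal.comp hcW)).add
        (((hcexp _).mul h1).mul (Complex.continuous_ofReal.comp (hcW.mul h2)))
  have htot : ∫ x in torusDomain P, ∑ w, df w x = 0 := by
    rw [integral_finsetSum _ fun w _ => hint w]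
    simp [hdf]
  simp only [hsum] at htot
  rw [integral_const_mul] at htot
  exact (mul_eq_zero.mp htot).resolve_left Complex.I_ne_zero

/-- Dominated convergence: the quotients are at most 1 and tend to 1 off the walls, a null set, and
the regularized weight increases with δ, so its value at δ = 1 dominates. -/
theorem integral_weight_eq_zero_of_regularized {g : ι → ℝ} (hg : ∀ i, 0 ≤ g i) {A : E → ℂ}
    {B : ι → E → ℂ} (hA : Continuous A) (hB : ∀ i, Continuous (B i))
    (h : ∀ δ : ℝ, 0 < δ → ∫ x in torusDomain P, (A x + ∑ i, B i x *
      ((‖1 - expo (P.root i) x‖ ^ 2 / (‖1 - expo (P.root i) x‖ ^ 2 + δ) : ℝ) : ℂ)) *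
        (regWeight P g δ x : ℂ) = 0) :
    ∫ x in torusDomain P, (A x + ∑ i, B i x) * (weight P g x : ℂ) = 0 := by
  set r : ι → E → ℝ := fun i x => ‖1 - expo (P.root i) x‖ ^ 2 with hr
  have hr0 : ∀ i x, 0 ≤ r i x := fun i x => by positivity
  let δ : ℕ → ℝ := fun n => 1 / ((n : ℝ) + 1)
  have hδ : ∀ n, 0 < δ n := fun n => by positivity
  have hδ1 : ∀ n, δ n ≤ 1 := fun n => by
    rw [div_le_one (by positivity)]
    linarith [(Nat.cast_nonneg n : (0 : ℝ) ≤ n)]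
  have hδ0 : Tendsto δ atTop (𝓝 0) := tendsto_one_div_add_atTop_nhds_zero_nat
  have hlim := tendsto_integral_of_dominated_convergence
    (μ := (volume : Measure E).restrict (torusDomain P))
    (F := fun n x => (A x + ∑ i, B i x * ((r i x / (r i x + δ n) : ℝ) : ℂ)) *
      (regWeight P g (δ n) x : ℂ)) (f := fun x => (A x + ∑ i, B i x) * (weight P g x : ℂ))
    (fun x => (‖A x‖ + ∑ i, ‖B i x‖) * regWeight P g 1 x) ?_ ?_ ?_ ?_
  · exact tendsto_nhds_unique hlim (tendsto_const_nhds.congr fun n => (h _ (hδ n)).symm)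
  · intro n
    refine Continuous.aestronglyMeasurable ?_
    have h1 : ∀ i, Continuous fun x => r i x / (r i x + δ n) := fun i =>
      have := continuous_expo (P.root i)
      Continuous.div (by fun_prop) (by fun_prop) fun x =>
        (add_pos_of_nonneg_of_pos (hr0 i x) (hδ n)).ne'
    exact (hA.add (continuous_finsetSum _ fun i _ => (hB i).mul
      (Complex.continuous_ofReal.comp (h1 i)))).mul
        (Complex.continuous_ofReal.comp (continuous_regWeight hg _))
  · exact integrableOn_torusDomain P
      ((hA.norm.add (continuous_finsetSum _ fun i _ => (hB i).norm)).mul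
        (continuous_regWeight hg _))
  · refine fun n => .of_forall fun x => ?_
    rw [norm_mul, Complex.norm_real, Real.norm_of_nonneg (regWeight_nonneg g (hδ n).le x)]
    refine mul_le_mul ?_ (regWeight_le hg (hδ n).le (hδ1 n) x) (regWeight_nonneg g (hδ n).le x)
      (by positivity)
    refine (norm_add_le _ _).trans (add_le_add le_rfl ((norm_sum_le _ _).trans
      (Finset.sum_le_sum fun i _ => ?_)))
    have h0 : 0 ≤ r i x / (r i x + δ n) := div_nonneg (hr0 i x) (add_nonneg (hr0 i x) (hδ n).le)
    have h1 : r i x / (r i x + δ n) ≤ 1 :=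
      div_le_one_of_le₀ (by linarith [hδ n]) (add_nonneg (hr0 i x) (hδ n).le)
    rw [norm_mul, Complex.norm_real, Real.norm_of_nonneg h0]
    exact mul_le_of_le_one_right (norm_nonneg _) h1
  · have hne : ∀ᵐ x ∂(volume : Measure E), ∀ i, expo (P.root i) x ≠ 1 :=
      ae_all_iff.mpr fun i => ae_expo_ne_one (P.ne_zero i)
    filter_upwards [ae_restrict_of_ae hne] with x hx
    refine Tendsto.mul (tendsto_const_nhds.add (tendsto_finsetSum _ fun i _ => ?_))
      ((Complex.continuous_ofReal.tendsto _).comp ((tendsto_regWeight hg x).comp hδ0))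
    have hri : r i x ≠ 0 := by
      simpa [hr, sub_eq_zero] using (hx i).symm
    have h1 : Tendsto (fun n => r i x / (r i x + δ n)) atTop (𝓝 (r i x / (r i x + 0))) :=
      tendsto_const_nhds.div (tendsto_const_nhds.add hδ0) (by simpa using hri)
    rw [add_zero, div_self hri] at h1
    have h2 := ((Complex.continuous_ofReal.tendsto _).comp h1).const_mul (B i x)
    rw [Complex.ofReal_one, mul_one] at h2
    exact h2

/-- Integration by parts on the torus. -/
theorem integral_hypergeometricOp_mul {g : ι → ℝ} (hg : ∀ i, 0 ≤ g i) {μ κ : E}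
    (hμ : IsIntegral P μ) (hκ : IsIntegral P κ) :
    ∫ x in torusDomain P, hypergeometricOp P g μ x * conj (weylSum P κ x) * (weight P g x : ℂ) =
      ∫ x in torusDomain P, gradInner P μ κ x * (weight P g x : ℂ) := by
  have hcM : ∀ μ : E, Continuous (weylSum P μ) := continuous_weylSum
  have hcMc := Complex.continuous_conj.comp (hcM κ)
  have hcT := fun i => continuous_stringTerm (P := P) i μ
  have hcW := Complex.continuous_ofReal.comp (continuous_weight (P := P) hg)
  have hcG := continuous_gradInner P μ κ
  have h := integral_weight_eq_zero_of_regularized (P := P) hg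
    (A := fun x => (⟪μ, μ⟫_ℝ : ℂ) * weylSum P μ x * conj (weylSum P κ x) - gradInner P μ κ x)
    (B := fun i x => (1 / 2) * (g i : ℂ) * stringTerm P i μ x * conj (weylSum P κ x))
    (((continuous_const.mul (hcM μ)).mul hcMc).sub hcG)
    (fun i => (continuous_const.mul (hcT i)).mul hcMc)
    fun δ hδ => integral_div_regularized_eq_zero hg hδ hμ hκ
  rw [← sub_eq_zero, ← integral_sub, ← h]
  · refine integral_congr_ae (.of_forall fun x => ?_)
    simp only [hypergeometricOp]
    have : ∑ i, (1 / 2) * (g i : ℂ) * stringTerm P i μ x * conj (weylSum P κ x) =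
        (1 / 2) * (∑ i, (g i : ℂ) * stringTerm P i μ x) * conj (weylSum P κ x) := by
      rw [Finset.mul_sum, Finset.sum_mul]
      refine Finset.sum_congr rfl fun i _ => ?_
      ring
    rw [this]
    ring
  · refine integrableOn_torusDomain P (((?_ : Continuous _).mul hcMc).mul hcW)
    exact (continuous_const.mul (hcM μ)).add (continuous_const.mul
      (continuous_finsetSum _ fun i _ => continuous_const.mul (hcT i)))
  · exact integrableOn_torusDomain P (hcG.mul hcW)

/-- Integration by parts leads to the integral of `gradInner`, which is Hermitian in μ and κ. -/
theorem integral_hypergeometricOp_symm {g : ι → ℝ} (hg : ∀ i, 0 ≤ g i) {μ κ : E}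
    (hμ : IsIntegral P μ) (hκ : IsIntegral P κ) :
    ∫ x in torusDomain P, hypergeometricOp P g μ x * conj (weylSum P κ x) * (weight P g x : ℂ) =
      ∫ x in torusDomain P,
        weylSum P μ x * conj (hypergeometricOp P g κ x) * (weight P g x : ℂ) := by
  have h := congrArg conj (integral_hypergeometricOp_mul hg hκ hμ)
  rw [← integral_conj, ← integral_conj] at h
  rw [integral_hypergeometricOp_mul hg hμ hκ]
  simp only [map_mul, Complex.conj_conj, Complex.conj_ofReal, conj_gradInner] at h
  rw [← h]
  simp only [mul_comm (conj _)]

end SelfAdjoint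

end HeckmanOpdam

namespace HeckmanOpdam

open MeasureTheory Filter
open scoped Topology Pointwise

/-! ### Linear independence of the m_μ -/

section LinearIndependence

variable {E : Type*} [NormedAddCommGroup E] [InnerProductSpace ℝ E]

theorem expo_injective : Function.Injective (expo : E → E → ℂ) := by
  intro μ ν h
  by_contra hne
  have hd : ⟪μ - ν, μ - ν⟫_ℝ ≠ 0 := inner_self_ne_zero.mpr (sub_ne_zero.mpr hne)
  -- For d = μ - ν, the point π d/|d|² is chosen because e^d takes the value e^{iπ} = -1 there.
  have h1 : expo (μ - ν) ((Real.pi / ⟪μ - ν, μ - ν⟫_ℝ) • (μ - ν)) = 1 := by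
    rw [sub_eq_add_neg, expo_add, h, mul_comm, expo_neg_mul]
  rw [expo, inner_smul_right, div_mul_cancel₀ _ hd, mul_comm, Complex.exp_pi_mul_I] at h1
  norm_num at h1

/-- Dedekind's independence of distinct characters, applied to the additive group of E. -/
theorem linearIndependent_expo : LinearIndependent ℂ (expo : E → E → ℂ) := by
  let χ : E → (Multiplicative E →* ℂ) := fun μ =>
    { toFun := fun x => expo μ x.toAdd
      map_one' := by simp [expo]
      map_mul' := fun x y => expo_add_right μ _ _ }
  have hχ : Function.Injective χ := fun μ ν h =>
    expo_injective (funext fun x => DFunLike.congr_fun h (Multiplicative.ofAdd x))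
  exact (linearIndependent_monoidHom (Multiplicative E) ℂ).comp χ hχ

variable {ι : Type*} [Finite ι] {N : Type*} [AddCommGroup N] [Module ℝ N]
  {P : RootPairing ι ℝ E N} [P.IsRootSystem] [P.IsCrystallographic] [P.IsEuclidean] {Φ : Finset ι}

/-- Among the given m_μ only m_{μ₀} contains e^{μ₀}, since an orbit has only one dominant weight. -/
theorem eq_zero_of_sum_mul_monomial_eq_zero (hΦ : IsPositiveSystem P Φ) {S : Finset E}
    (hS : ∀ μ ∈ S, IsDominant P Φ μ) {c : E → ℂ}
    (h : ∀ x, ∑ μ ∈ S, c μ * monomial P μ x = 0) : ∀ μ ∈ S, c μ = 0 := by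
  classical
  intro μ₀ hμ₀
  let a : E → ℂ := fun μ => c μ * (stabOrder P μ : ℂ)⁻¹
  let l : E →₀ ℂ := ∑ μ ∈ S, ∑ w : P.weylGroup, Finsupp.single (w • μ) (a μ)
  have hl : Finsupp.linearCombination ℂ (expo : E → E → ℂ) l = 0 := by
    funext x
    simp only [l, map_sum, Finsupp.linearCombination_single, Finset.sum_apply, Pi.smul_apply,
      smul_eq_mul, ← Finset.mul_sum]
    rw [Pi.zero_apply, ← h x]
    refine Finset.sum_congr rfl fun μ _ => ?_
    rw [monomial_eq, ← mul_assoc]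
    rfl
  have hl0 : l = 0 := linearIndependent_iff.mp linearIndependent_expo l hl
  have h1 : l μ₀ = ∑ w : P.weylGroup, if w • μ₀ = μ₀ then a μ₀ else 0 := by
    simp only [l, Finsupp.finsetSum_apply, Finsupp.single_apply]
    refine Finset.sum_eq_single_of_mem μ₀ hμ₀ fun μ hμ hne => ?_
    refine Finset.sum_eq_zero fun w _ => if_neg fun hw => hne ?_
    exact ((hS μ₀ hμ₀).eq_of_mem_orbit hΦ (hS μ hμ) ⟨w, hw⟩).symm
  rw [hl0, ← Finset.sum_filter, Finset.sum_const, nsmul_eq_mul] at h1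
  have hcard : ((Finset.univ.filter fun w : P.weylGroup => w • μ₀ = μ₀).card : ℂ) ≠ 0 := by
    rw [Nat.cast_ne_zero, Finset.card_ne_zero]
    exact ⟨1, by simp⟩
  have ha : a μ₀ = 0 := (mul_eq_zero.mp h1.symm).resolve_left hcard
  exact (mul_eq_zero.mp ha).resolve_right
    (inv_ne_zero (Nat.cast_ne_zero.mpr (stabOrder_ne_zero P μ₀)))

end LinearIndependence

/-! ### Definiteness of the inner product and symmetry of the matrix -/

section TorusInner

variable {ι : Type*} [Fintype ι] {E : Type*} [NormedAddCommGroup E] [InnerProductSpace ℝ E]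
  {N : Type*} [AddCommGroup N] [Module ℝ N] {P : RootPairing ι ℝ E N} [P.IsRootSystem]
  [FiniteDimensional ℝ E] [P.IsCrystallographic] [P.IsEuclidean]
  [MeasurableSpace E] [BorelSpace E] {g : ι → ℝ}

theorem torusInner_sum_left (hg : ∀ i, 0 ≤ g i) (S : Finset E) (c : E → ℂ) {h : E → ℂ}
    (hh : Continuous h) : torusInner P g (fun x => ∑ μ ∈ S, c μ * monomial P μ x) h =
      ∑ μ ∈ S, c μ * torusInner P g (monomial P μ) h := by
  have hcW := Complex.continuous_ofReal.comp (continuous_weight (P := P) hg)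
  have hhc := Complex.continuous_conj.comp hh
  simp only [torusInner, Finset.sum_mul, mul_assoc]
  rw [integral_finsetSum, Finset.mul_sum]
  · refine Finset.sum_congr rfl fun μ _ => ?_
    rw [integral_const_mul]
    ring
  · exact fun μ _ => integrableOn_torusDomain P
      (continuous_const.mul ((continuous_monomial μ).mul (hhc.mul hcW)))

theorem torusInner_sum_right (hg : ∀ i, 0 ≤ g i) (S : Finset E) (c : E → ℂ) {f : E → ℂ}
    (hf : Continuous f) : torusInner P g f (fun x => ∑ μ ∈ S, c μ * monomial P μ x) =
      ∑ μ ∈ S, conj (c μ) * torusInner P g f (monomial P μ) := by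
  have hcW := Complex.continuous_ofReal.comp (continuous_weight (P := P) hg)
  have hcc : ∀ μ, Continuous fun x => conj (monomial P μ x) := fun μ =>
    Complex.continuous_conj.comp (continuous_monomial μ)
  simp only [torusInner, map_sum, map_mul, Finset.sum_mul, Finset.mul_sum]
  rw [integral_finsetSum, Finset.mul_sum]
  · refine Finset.sum_congr rfl fun μ _ => ?_
    rw [mul_left_comm, ← integral_const_mul (conj (c μ))]
    congr 2
    funext x
    ring
  · exact fun μ _ => integrableOn_torusDomain P
      ((hf.mul (continuous_const.mul (hcc μ))).mul hcW)

/-- The weight is positive almost everywhere, so f vanishes almost everywhere on the domain, then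
almost everywhere on E by periodicity, then identically by continuity. -/
theorem eq_zero_of_torusInner_self (hg : ∀ i, 0 ≤ g i) {f : E → ℂ} (hfc : Continuous f)
    (hfp : IsTorusPeriodic P f) (h : torusInner P g f f = 0) : f = 0 := by
  have hcW := continuous_weight (P := P) hg
  have hW0 : ∀ x, 0 ≤ weight P g x := fun x =>
    Finset.prod_nonneg fun _ _ => Real.rpow_nonneg (norm_nonneg _) _
  have hcard : (1 / (Nat.card P.weylGroup : ℂ)) ≠ 0 :=
    one_div_ne_zero (Nat.cast_ne_zero.mpr Nat.card_pos.ne')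
  have h1 := (mul_eq_zero.mp h).resolve_left hcard
  have h2 : ∫ x in torusDomain P, ‖f x‖ ^ 2 * weight P g x = 0 := by
    have h3 : ∀ x, f x * conj (f x) * (weight P g x : ℂ) =
        ((‖f x‖ ^ 2 * weight P g x : ℝ) : ℂ) := fun x => by
      rw [Complex.mul_conj, Complex.normSq_eq_norm_sq]
      push_cast
      ring
    simp only [h3] at h1
    rw [integral_complex_ofReal] at h1
    exact_mod_cast h1
  have hint : IntegrableOn (fun x => ‖f x‖ ^ 2 * weight P g x) (torusDomain P) :=
    integrableOn_torusDomain P ((hfc.norm.pow 2).mul hcW)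
  rw [integral_eq_zero_iff_of_nonneg (fun x => mul_nonneg (by positivity) (hW0 x)) hint] at h2
  have hne : ∀ᵐ x ∂(volume : Measure E), ∀ i, expo (P.root i) x ≠ 1 :=
    ae_all_iff.mpr fun i => ae_expo_ne_one (P.ne_zero i)
  have h4 : ∀ᵐ x ∂(volume : Measure E).restrict (torusDomain P), f x = 0 := by
    filter_upwards [h2, ae_restrict_of_ae hne] with x hx hx'
    have := (mul_eq_zero.mp hx).resolve_right (weight_pos hx').ne'
    simpa using this
  have h5 : (volume : Measure E) {x | f x ≠ 0} = 0 := by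
    have : VAddInvariantMeasure (torusLattice P) E volume :=
      inferInstanceAs <| VAddInvariantMeasure (torusLattice P).toAddSubgroup E volume
    refine (isAddFundamentalDomain_torusDomain P).measure_zero_of_invariant _ (fun y => ?_) ?_
    · ext x
      rw [Set.mem_vadd_set_iff_neg_vadd_mem]
      simp only [Set.mem_ofPred_eq]
      rw [show -y +ᵥ x = ((-y : torusLattice P) : E) + x from rfl, hfp _ (-y).2]
    · rw [ae_restrict_iff' (measurableSet_torusDomain P), ae_iff] at h4
      convert h4 using 2
      ext x
      simp [and_comm]
  exact Continuous.ae_eq_iff_eq volume hfc continuous_zero |>.mp h5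

variable {Φ : Finset ι}

/-- The matrix of the Heckman–Opdam Laplacian in the basis of the monomial symmetric functions. -/
noncomputable def opMatrix (P : RootPairing ι ℝ E N) (Φ : Finset ι) (g : ι → ℝ) (μ ν : E) : ℝ :=
  open Classical in (if μ = ν then eps P Φ g μ else 0) + dcoef P Φ g μ ν

omit [FiniteDimensional ℝ E] [MeasurableSpace E] [BorelSpace E] in
theorem hypergeometricOp_eq_sum_opMatrix
    (hgW : ∀ (w : P.weylGroup) (i : ι), g (P.weylGroupToPerm w i) = g i)
    (hΦ : IsPositiveSystem P Φ) {lam : E} {S : Finset E}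
    (hS : ∀ ν, ν ∈ S ↔ ν ∈ dominantBelow P Φ lam) {μ : E} (hμS : μ ∈ S) (x : E) :
    hypergeometricOp P g μ x =
      stabOrder P μ * ∑ ν ∈ S, (opMatrix P Φ g μ ν : ℂ) * monomial P ν x := by
  classical
  rw [hypergeometricOp_eq hgW hΦ hS hμS]
  congr 1
  simp only [opMatrix, Complex.ofReal_add, add_mul, Finset.sum_add_distrib]
  congr 1
  rw [Finset.sum_eq_single_of_mem μ hμS]
  · simp
  · intro ν _ hne
    simp [hne.symm]

/-- Symmetry of D in the basis m_μ, which need not be orthogonal, hence the Gram entries. The matrix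
is real, so no conjugate appears on the right. -/
theorem torusInner_opMatrix_symm (hg : ∀ i, 0 ≤ g i)
    (hgW : ∀ (w : P.weylGroup) (i : ι), g (P.weylGroupToPerm w i) = g i)
    (hΦ : IsPositiveSystem P Φ) {lam : E} {S : Finset E}
    (hS : ∀ ν, ν ∈ S ↔ ν ∈ dominantBelow P Φ lam) {μ κ : E} (hμS : μ ∈ S) (hκS : κ ∈ S) :
    ∑ ν ∈ S, (opMatrix P Φ g μ ν : ℂ) * torusInner P g (monomial P ν) (monomial P κ) =
      ∑ ν ∈ S, (opMatrix P Φ g κ ν : ℂ) * torusInner P g (monomial P μ) (monomial P ν) := by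
  have hμ := (((hS μ).mp hμS).1).isIntegral hΦ
  have hκ := (((hS κ).mp hκS).1).isIntegral hΦ
  have hsμ : (stabOrder P μ : ℂ) ≠ 0 := Nat.cast_ne_zero.mpr (stabOrder_ne_zero P μ)
  have hsκ : (stabOrder P κ : ℂ) ≠ 0 := Nat.cast_ne_zero.mpr (stabOrder_ne_zero P κ)
  have h := integral_hypergeometricOp_symm hg hμ hκ
  rw [← torusInner_sum_left (P := P) hg S (fun ν => (opMatrix P Φ g μ ν : ℂ))
    (continuous_monomial (P := P) κ)]
  have h2 := torusInner_sum_right (P := P) hg S (fun ν => (opMatrix P Φ g κ ν : ℂ))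
    (continuous_monomial (P := P) μ)
  simp only [Complex.conj_ofReal] at h2
  rw [← h2, torusInner, torusInner]
  congr 1
  -- The factor |W_μ||W_κ| turns monomials into sums over W, for which the symmetry is known.
  refine mul_left_cancel₀ (mul_ne_zero hsμ hsκ) ?_
  rw [← integral_const_mul, ← integral_const_mul]
  refine (integral_congr_ae (.of_forall fun x => ?_)).trans
    (h.trans (integral_congr_ae (.of_forall fun x => ?_)))
  · rw [hypergeometricOp_eq_sum_opMatrix hgW hΦ hS hμS, weylSum_eq, map_mul, Complex.conj_natCast]
    ring
  · beta_reduce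
    rw [hypergeometricOp_eq_sum_opMatrix hgW hΦ hS hκS, weylSum_eq, map_mul, Complex.conj_natCast]
    ring

/-- Definiteness in the shape that the Gram lemmas below take as hypothesis. -/
theorem eq_zero_of_sum_torusInner_eq_zero (hg : ∀ i, 0 ≤ g i) (hΦ : IsPositiveSystem P Φ)
    {S : Finset E} (hS : ∀ μ ∈ S, IsDominant P Φ μ) {c : E → ℂ}
    (h : ∑ κ ∈ S, conj (c κ) *
      ∑ μ ∈ S, c μ * torusInner P g (monomial P μ) (monomial P κ) = 0) :
    ∀ μ ∈ S, c μ = 0 := by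
  set f : E → ℂ := fun x => ∑ μ ∈ S, c μ * monomial P μ x with hf
  have hfc : Continuous f :=
    continuous_finsetSum _ fun μ _ => continuous_const.mul (continuous_monomial μ)
  have hfp : IsTorusPeriodic P f := fun y hy x => Finset.sum_congr rfl fun μ hμ => by
    rw [isTorusPeriodic_monomial ((hS μ hμ).isIntegral hΦ) y hy x]
  have h1 : torusInner P g f f = 0 := by
    rw [← h, hf, torusInner_sum_right hg S c hfc]
    refine Finset.sum_congr rfl fun κ _ => ?_
    rw [torusInner_sum_left hg S c (continuous_monomial κ)]
  have h2 := eq_zero_of_torusInner_self hg hfc hfp h1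
  exact eq_zero_of_sum_mul_monomial_eq_zero hΦ hS fun x => congrFun h2 x

end TorusInner

/-! ### Orthogonality and eigenvectors from a definite Gram matrix -/

section Gram

variable {α : Type*} {S : Finset α} {G : α → α → ℂ}

/-- A vector that is orthogonal to all members but one of a linearly independent family exists. -/
theorem exists_orthogonal_of_gram [DecidableEq α]
    (hG : ∀ c : α → ℂ, ∑ κ ∈ S, conj (c κ) * ∑ μ ∈ S, c μ * G μ κ = 0 → ∀ μ ∈ S, c μ = 0)
    {a : α} (ha : a ∈ S) :
    ∃ c : α → ℂ, c a = 1 ∧ ∀ κ ∈ S, κ ≠ a → ∑ μ ∈ S, c μ * G μ κ = 0 := by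
  set T := S.erase a with hT
  let ext : (T → ℂ) → α → ℂ := fun b μ => if h : μ ∈ T then b ⟨μ, h⟩ else 0
  have hext : ∀ (b : T → ℂ) (κ : α), ∑ μ ∈ S, ext b μ * G μ κ = ∑ μ : T, b μ * G μ κ := by
    intro b κ
    have hea : ext b a = 0 := dif_neg (Finset.notMem_erase a S)
    rw [← Finset.add_sum_erase S _ ha, hea, zero_mul, zero_add, ← Finset.sum_coe_sort]
    refine Finset.sum_congr rfl fun μ _ => ?_
    simp only [ext]
    rw [dif_pos μ.2]
  let L : (T → ℂ) →ₗ[ℂ] (T → ℂ) :=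
    { toFun := fun b κ => ∑ μ : T, b μ * G μ κ
      map_add' := fun b b' => by
        funext κ
        simp [add_mul, Finset.sum_add_distrib]
      map_smul' := fun t b => by
        funext κ
        simp [mul_assoc, Finset.mul_sum] }
  have hinj : Function.Injective L := by
    rw [← LinearMap.ker_eq_bot, LinearMap.ker_eq_bot']
    intro b hb
    have h := hG (ext b) (Finset.sum_eq_zero fun κ _ => by
      by_cases hκ : κ ∈ T
      · rw [hext, show ∑ μ : T, b μ * G μ κ = 0 from congrFun hb ⟨κ, hκ⟩, mul_zero]
      · rw [show ext b κ = 0 from dif_neg hκ, map_zero, zero_mul])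
    funext μ
    have := h μ (Finset.mem_of_mem_erase μ.2)
    simp only [ext] at this
    rw [dif_pos μ.2] at this
    exact this
  -- The Gram matrix of the other members is injective by definiteness, hence surjective. The
  -- right-hand side is chosen so that member a plus the combination b is orthogonal to them.
  obtain ⟨b, hb⟩ := LinearMap.injective_iff_surjective.mp hinj fun κ => -G a κ
  refine ⟨fun μ => if μ = a then 1 else ext b μ, if_pos rfl, fun κ hκ hne => ?_⟩
  have hκT : κ ∈ T := Finset.mem_erase.mpr ⟨hne, hκ⟩
  have h1 : ∑ μ : T, b μ * G μ κ = -G a κ := congrFun hb ⟨κ, hκT⟩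
  rw [← hext, ← Finset.add_sum_erase S _ ha, show ext b a = 0 from
    dif_neg (Finset.notMem_erase a S), zero_mul, zero_add] at h1
  rw [← Finset.add_sum_erase S _ ha]
  beta_reduce
  rw [if_pos rfl, one_mul,
    Finset.sum_congr rfl fun μ hμ => by rw [if_neg (Finset.ne_of_mem_erase hμ)], h1,
    add_neg_cancel]

/-- The combination lies in the span of the other members and is orthogonal to them, hence to
itself. -/
theorem eq_zero_of_orthogonal
    (hG : ∀ c : α → ℂ, ∑ κ ∈ S, conj (c κ) * ∑ μ ∈ S, c μ * G μ κ = 0 → ∀ μ ∈ S, c μ = 0)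
    {a : α} {b : α → ℂ} (hba : b a = 0)
    (hb : ∀ κ ∈ S, κ ≠ a → ∑ μ ∈ S, b μ * G μ κ = 0) : ∀ μ ∈ S, b μ = 0 := by
  refine hG b (Finset.sum_eq_zero fun κ hκ => ?_)
  by_cases h : κ = a
  · rw [h, hba, map_zero, zero_mul]
  · rw [hb κ hκ h, mul_zero]

/-- If `A` is the matrix of a symmetric operator and preserves the span of all members but one of
the family, then the vector orthogonal to that span is an eigenvector. -/
theorem eigenvector_of_orthogonal
    (hG : ∀ c : α → ℂ, ∑ κ ∈ S, conj (c κ) * ∑ μ ∈ S, c μ * G μ κ = 0 → ∀ μ ∈ S, c μ = 0)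
    {A : α → α → ℂ}
    (hA : ∀ μ ∈ S, ∀ κ ∈ S, ∑ ν ∈ S, A μ ν * G ν κ = ∑ ν ∈ S, A κ ν * G μ ν)
    {a : α} (ha : a ∈ S) (hAa : ∀ μ ∈ S, μ ≠ a → A μ a = 0) {c : α → ℂ}
    (hc : ∀ κ ∈ S, κ ≠ a → ∑ μ ∈ S, c μ * G μ κ = 0) :
    ∀ ν ∈ S, ∑ μ ∈ S, c μ * A μ ν = A a a * c ν := by
  -- The vector cA - A_{aa}c has no component at a. It is orthogonal to the other members because
  -- symmetry moves A onto them and A preserves their span.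
  have key := eq_zero_of_orthogonal hG (a := a)
    (b := fun ν => ∑ μ ∈ S, c μ * A μ ν - A a a * c ν) ?_ ?_
  · exact fun ν hν => sub_eq_zero.mp (key ν hν)
  · rw [Finset.sum_eq_single_of_mem a ha fun μ hμ hne => by rw [hAa μ hμ hne, mul_zero],
      mul_comm, sub_self]
  · intro κ hκ hne
    simp only [sub_mul, Finset.sum_sub_distrib, mul_assoc]
    rw [← Finset.mul_sum, hc κ hκ hne, mul_zero, sub_zero]
    simp only [Finset.sum_mul]
    rw [Finset.sum_comm]
    have h1 : ∀ μ ∈ S, ∑ ν ∈ S, c μ * A μ ν * G ν κ = ∑ ν ∈ S, A κ ν * (c μ * G μ ν) := by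
      intro μ hμ
      simp only [mul_assoc]
      rw [← Finset.mul_sum, hA μ hμ κ hκ, Finset.mul_sum]
      exact Finset.sum_congr rfl fun ν _ => by ring
    rw [Finset.sum_congr rfl h1, Finset.sum_comm]
    refine Finset.sum_eq_zero fun ν hν => ?_
    rw [← Finset.mul_sum]
    by_cases h : ν = a
    · rw [h, hAa κ hκ hne, zero_mul]
    · rw [hc ν hν h, mul_zero]

end Gram

/-! ### A Hessenberg determinant -/

section Hessenberg

/-- The determinant of a lower Hessenberg matrix whose rows, from the second column on, satisfy a
linear relation. -/
theorem det_hessenberg {n : ℕ} (H : Matrix (Fin (n + 1)) (Fin (n + 1)) ℂ)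
    (hH : ∀ (j : Fin (n + 1)) (k : Fin n), j < k.castSucc → H j k.succ = 0)
    (c : Fin (n + 1) → ℂ) (hc : c (Fin.last n) = 1)
    (hrel : ∀ k : Fin n, ∑ j, c j * H j k.succ = 0) :
    H.det = (∑ j, c j * H j 0) * ∏ k : Fin n, -H k.castSucc k.succ := by
  -- Replacing the last row by the combination of all rows keeps the determinant, since its own
  -- coefficient is 1; the new row vanishes after its first entry.
  have h1 := Matrix.det_updateRow_sum H (Fin.last n) c
  rw [hc, one_smul] at h1
  have hrow0 : (∑ k, c k • H k) 0 = ∑ j, c j * H j 0 := by simp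
  have hrow : ∀ k : Fin n, (∑ k, c k • H k) k.succ = 0 := fun k => by simpa using hrel k
  rw [← h1, Matrix.det_succ_row _ (Fin.last n), Fin.sum_univ_succ]
  have h2 : ∀ k : Fin n, (-1 : ℂ) ^ (((Fin.last n : Fin (n + 1)) : ℕ) + (k.succ : ℕ)) *
      (H.updateRow (Fin.last n) (∑ k, c k • H k)) (Fin.last n) k.succ *
        ((H.updateRow (Fin.last n) (∑ k, c k • H k)).submatrix (Fin.last n).succAbove
          k.succ.succAbove).det = 0 := fun k => by
    rw [Matrix.updateRow_self, hrow, mul_zero, zero_mul]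
  rw [Finset.sum_eq_zero fun k _ => h2 k, add_zero, Matrix.updateRow_self, hrow0]
  -- The minor without last row and first column is lower triangular, with the superdiagonal of H as
  -- its diagonal. The cofactor sign (-1)^n becomes the minus signs in the product.
  have h3 : (H.updateRow (Fin.last n) (∑ k, c k • H k)).submatrix (Fin.last n).succAbove
      (Fin.succAbove 0) = Matrix.of fun i j : Fin n => H i.castSucc j.succ := by
    ext i j
    rw [Matrix.submatrix_apply, Fin.succAbove_last, Matrix.updateRow_ne (Fin.castSucc_lt_last i).ne]
    rfl
  rw [h3, Matrix.det_of_isLowerTriangular _ (fun i j hij => ?_)]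
  · have h4 : ∏ k : Fin n, -H k.castSucc k.succ =
        (-1) ^ n * ∏ k : Fin n, H k.castSucc k.succ := by
      rw [Finset.prod_neg]
      simp
    rw [h4]
    simp only [Fin.val_last, Fin.val_zero, add_zero, Matrix.of_apply]
    ring
  · exact hH _ _ (Fin.castSucc_lt_castSucc_iff.mpr (OrderDual.toDual_lt_toDual.mp hij))

end Hessenberg

/-! ### Triangular recurrences and sums over chains -/

section Chains

variable {n : ℕ}

open Classical in
/-- The sum over the strictly decreasing chains with `r` steps from `n` to `l` of products of
weights of the steps. -/
noncomputable def chainWeight (d : Fin (n + 1) → Fin (n + 1) → ℝ) (q : Fin (n + 1) → ℝ) (r : ℕ)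
    (l : Fin (n + 1)) : ℝ :=
  ∑ j : Fin (r + 1) → Fin (n + 1) with StrictAnti j ∧ j 0 = Fin.last n ∧ j (Fin.last r) = l,
    (∏ k : Fin r, d (j k.castSucc) (j k.succ)) / ∏ k : Fin r, q (j k.succ)

theorem strictAnti_snoc_iff {r : ℕ} {j : Fin (r + 1) → Fin (n + 1)} {l : Fin (n + 1)} :
    StrictAnti (Fin.snoc (α := fun _ => Fin (n + 1)) j l) ↔
      StrictAnti j ∧ l < j (Fin.last r) := by
  constructor
  · intro h
    constructor
    · intro a b hab
      have := h (Fin.castSucc_lt_castSucc_iff.mpr hab)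
      simpa using this
    · have := h (Fin.castSucc_lt_last (Fin.last r))
      simpa using this
  · rintro ⟨h, hl⟩
    rw [Fin.strictAnti_iff_succ_lt]
    intro i
    induction i using Fin.lastCases with
    | last => simpa [Fin.succ_last] using hl
    | cast i =>
      rw [Fin.succ_castSucc, Fin.snoc_castSucc, Fin.snoc_castSucc]
      exact h Fin.castSucc_lt_succ

theorem chainWeight_zero (d : Fin (n + 1) → Fin (n + 1) → ℝ) (q : Fin (n + 1) → ℝ)
    (l : Fin (n + 1)) : chainWeight d q 0 l = if l = Fin.last n then 1 else 0 := by
  classical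
  have : Subsingleton (Fin (0 + 1)) := inferInstanceAs (Subsingleton (Fin 1))
  unfold chainWeight
  simp only [Finset.univ_eq_empty, Finset.prod_empty, div_one, Finset.sum_const, nsmul_eq_mul,
    mul_one]
  split_ifs with h
  · subst h
    rw [Finset.card_eq_one.mpr ⟨fun _ => Fin.last n, ?_⟩, Nat.cast_one]
    ext j
    simp only [Finset.mem_filter, Finset.mem_univ, true_and, Finset.mem_singleton]
    constructor
    · rintro ⟨-, h, -⟩
      funext i
      rw [Subsingleton.elim i 0, h]
    · rintro rfl
      exact ⟨Subsingleton.strictAnti _, rfl, rfl⟩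
  · rw [Nat.cast_eq_zero, Finset.card_eq_zero, Finset.filter_eq_empty_iff]
    rintro j - ⟨-, h1, h2⟩
    exact h (h2.symm.trans h1)

/-- The last entry l of the chain is split off; k is the entry before it. -/
theorem chainWeight_succ (d : Fin (n + 1) → Fin (n + 1) → ℝ) (q : Fin (n + 1) → ℝ) (r : ℕ)
    (l : Fin (n + 1)) : chainWeight d q (r + 1) l =
      1 / q l * ∑ k ∈ Finset.Ioi l, chainWeight d q r k * d k l := by
  classical
  have h1 : ∀ k, chainWeight d q r k * d k l =
      ∑ j : Fin (r + 1) → Fin (n + 1) with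
          StrictAnti j ∧ j 0 = Fin.last n ∧ j (Fin.last r) = k,
        ((∏ k : Fin r, d (j k.castSucc) (j k.succ)) / ∏ k : Fin r, q (j k.succ)) *
          d (j (Fin.last r)) l := by
    intro k
    rw [chainWeight, Finset.sum_mul]
    refine Finset.sum_congr rfl fun j hj => ?_
    rw [(Finset.mem_filter.mp hj).2.2.2]
  have h2 : ∑ k ∈ Finset.Ioi l, chainWeight d q r k * d k l =
      ∑ j : Fin (r + 1) → Fin (n + 1) with
          StrictAnti j ∧ j 0 = Fin.last n ∧ l < j (Fin.last r),
        ((∏ k : Fin r, d (j k.castSucc) (j k.succ)) / ∏ k : Fin r, q (j k.succ)) *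
          d (j (Fin.last r)) l := by
    rw [Finset.sum_congr rfl fun k _ => h1 k]
    refine Eq.trans ?_ (Finset.sum_fiberwise_of_maps_to
      (t := Finset.Ioi l) (g := fun j : Fin (r + 1) → Fin (n + 1) => j (Fin.last r))
      (fun j hj => by simpa using (Finset.mem_filter.mp hj).2.2.2) _)
    refine Finset.sum_congr rfl fun k hk => ?_
    rw [Finset.filter_filter]
    refine Finset.sum_congr (Finset.filter_congr fun j _ => ?_) fun _ _ => rfl
    rw [Finset.mem_Ioi] at hk
    constructor
    · rintro ⟨h, h', rfl⟩
      exact ⟨⟨h, h', hk⟩, rfl⟩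
    · rintro ⟨⟨h, h', -⟩, h''⟩
      exact ⟨h, h', h''⟩
  rw [h2, Finset.mul_sum, chainWeight]
  refine Finset.sum_nbij' (fun j => Fin.init (α := fun _ => Fin (n + 1)) j)
    (fun j => Fin.snoc (α := fun _ => Fin (n + 1)) j l) ?_ ?_ ?_ ?_ ?_
  · intro j hj
    obtain ⟨-, h, h0, hl⟩ := Finset.mem_filter.mp hj
    rw [← Fin.snoc_init_self j, strictAnti_snoc_iff] at h
    rw [Finset.mem_filter]
    exact ⟨Finset.mem_univ _, h.1, h0, hl ▸ h.2⟩
  · intro j hj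
    obtain ⟨-, h, h0, hl⟩ := Finset.mem_filter.mp hj
    rw [Finset.mem_filter, strictAnti_snoc_iff]
    refine ⟨Finset.mem_univ _, ⟨h, hl⟩, ?_, Fin.snoc_last _ _⟩
    rw [← h0, ← Fin.castSucc_zero, Fin.snoc_castSucc]
  · intro j hj
    obtain ⟨-, -, -, hl⟩ := Finset.mem_filter.mp hj
    rw [← hl]
    exact Fin.snoc_init_self j
  · intro j _
    exact Fin.init_snoc _ _
  · intro j hj
    obtain ⟨-, -, -, hl⟩ := Finset.mem_filter.mp hj
    rw [Fin.prod_univ_castSucc, Fin.prod_univ_castSucc, Fin.succ_last, hl]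
    simp only [Fin.init, Fin.succ_castSucc]
    ring

/-- A strictly decreasing chain from n to l has at most n - l steps. -/
theorem chainWeight_eq_zero (d : Fin (n + 1) → Fin (n + 1) → ℝ) (q : Fin (n + 1) → ℝ) {r : ℕ}
    {l : Fin (n + 1)} (h : n < r + l) : chainWeight d q r l = 0 := by
  induction r generalizing l with
  | zero => lia
  | succ r ih =>
    rw [chainWeight_succ, Finset.sum_eq_zero, mul_zero]
    intro k hk
    have := Finset.mem_Ioi.mp hk
    rw [ih (by lia), zero_mul]

/-- The range on the left does not depend on l, which suits the induction; the additional terms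
vanish. -/
theorem sum_chainWeight_eq (d : Fin (n + 1) → Fin (n + 1) → ℝ) (q : Fin (n + 1) → ℝ)
    {l : Fin (n + 1)} (hl : l ≠ Fin.last n) :
    ∑ r ∈ Finset.range (n + 1), chainWeight d q r l =
      ∑ r ∈ Finset.Icc 1 (n - (l : ℕ)), chainWeight d q r l := by
  symm
  refine Finset.sum_subset (fun r hr => ?_) fun r _ hr => ?_
  · rw [Finset.mem_Icc] at hr
    rw [Finset.mem_range]
    lia
  · rw [Finset.mem_Icc] at hr
    rcases r with _ | r
    · rw [chainWeight_zero, if_neg hl]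
    · exact chainWeight_eq_zero d q (by lia)

/-- A solution of a triangular recurrence is given by the sums over chains. -/
theorem eq_sum_chainWeight (d : Fin (n + 1) → Fin (n + 1) → ℝ) (q : Fin (n + 1) → ℝ)
    {c : Fin (n + 1) → ℂ} (hlast : c (Fin.last n) = 1)
    (hrec : ∀ l, l ≠ Fin.last n → c l =
      (1 / (q l : ℂ)) * ∑ k ∈ Finset.Ioi l, c k * (d k l : ℂ)) (l : Fin (n + 1)) :
    c l = ((∑ r ∈ Finset.range (n + 1), chainWeight d q r l : ℝ) : ℂ) := by
  induction l using WellFoundedGT.induction with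
  | _ l ih =>
    by_cases hl : l = Fin.last n
    · rw [hl, hlast, Finset.sum_range_succ', chainWeight_zero, if_pos rfl, Finset.sum_eq_zero]
      · simp
      · exact fun r _ => chainWeight_eq_zero d q (by simp)
    · rw [hrec l hl, Finset.sum_range_succ', chainWeight_zero, if_neg hl, add_zero]
      simp only [chainWeight_succ]
      rw [← Finset.mul_sum, Finset.sum_comm]
      push_cast
      congr 1
      refine Finset.sum_congr rfl fun k hk => ?_
      have hk' := Finset.mem_Ioi.mp hk
      -- The sum for k has one term more, r = n, which vanishes because k > l ≥ 0.
      rw [ih k hk', Finset.sum_range_succ, chainWeight_eq_zero d q (r := n) (by lia), add_zero,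
        Complex.ofReal_sum, Finset.sum_mul]

end Chains

/-! ### Existence, recurrence, closed form and determinant -/

section Main

variable {ι : Type*} [Fintype ι] {E : Type*} [NormedAddCommGroup E] [InnerProductSpace ℝ E]
  {N : Type*} [AddCommGroup N] [Module ℝ N] {P : RootPairing ι ℝ E N} [P.IsRootSystem]
  [FiniteDimensional ℝ E] [P.IsCrystallographic] [P.IsEuclidean] {Φ : Finset ι} {g : ι → ℝ}
  {lam : E}

omit [Fintype ι] [P.IsRootSystem] [FiniteDimensional ℝ E] [P.IsCrystallographic]
  [P.IsEuclidean] in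
theorem expansion_eq_sum {S : Finset E} (hS : ∀ ν, ν ∈ S ↔ ν ∈ dominantBelow P Φ lam)
    (c : E → ℂ) (x : E) : expansion P Φ lam c x = ∑ μ ∈ S, c μ * monomial P μ x := by
  have h : dominantBelow P Φ lam = ↑S := by
    ext ν
    exact (hS ν).symm
  rw [expansion, h, finsum_mem_coe_finset]

omit [Fintype ι] [P.IsRootSystem] [FiniteDimensional ℝ E] [P.IsCrystallographic]
  [P.IsEuclidean] in
theorem mem_dominantBelow_self (hlam : IsDominant P Φ lam) : lam ∈ dominantBelow P Φ lam :=
  ⟨hlam, Preceq.refl lam⟩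

omit [FiniteDimensional ℝ E] [P.IsRootSystem] in
-- The span of the m_μ with μ ≺ lam is invariant under D.
theorem opMatrix_top (hΦ : IsPositiveSystem P Φ) (hlam : IsDominant P Φ lam) {μ : E}
    (hμ : μ ∈ dominantBelow P Φ lam) (hne : μ ≠ lam) : opMatrix P Φ g μ lam = 0 := by
  rw [opMatrix, if_neg hne, zero_add]
  by_contra h
  obtain ⟨h1, -⟩ := preceq_and_ne_of_dcoef_ne_zero hΦ hμ.1 h
  exact hne (hμ.1.preceq_antisymm hlam hμ.2 h1)

omit [FiniteDimensional ℝ E] [P.IsRootSystem] in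
theorem opMatrix_self (hΦ : IsPositiveSystem P Φ) {μ : E} (hμ : IsDominant P Φ μ) :
    opMatrix P Φ g μ μ = eps P Φ g μ := by
  have h : dcoef P Φ g μ μ = 0 := by
    by_contra h
    exact (preceq_and_ne_of_dcoef_ne_zero hΦ hμ h).2 rfl
  rw [opMatrix, if_pos rfl, h, add_zero]

variable [MeasurableSpace E] [BorelSpace E]

theorem torusInner_expansion (hg : ∀ i, 0 ≤ g i) {S : Finset E}
    (hS : ∀ ν, ν ∈ S ↔ ν ∈ dominantBelow P Φ lam) (c : E → ℂ) (κ : E) :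
    torusInner P g (expansion P Φ lam c) (monomial P κ) =
      ∑ μ ∈ S, c μ * torusInner P g (monomial P μ) (monomial P κ) := by
  rw [show expansion P Φ lam c = fun x => ∑ μ ∈ S, c μ * monomial P μ x from
    funext (expansion_eq_sum hS c), torusInner_sum_left hg S c (continuous_monomial κ)]

theorem existsUnique_isHeckmanOpdam (hΦ : IsPositiveSystem P Φ) (hg : ∀ i, 0 ≤ g i)
    (hlam : IsDominant P Φ lam) : ∃! p : E → ℂ, IsHeckmanOpdam P Φ g lam p := by
  classical
  set S := (finite_dominantBelow hΦ lam).toFinset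
  have hS : ∀ ν, ν ∈ S ↔ ν ∈ dominantBelow P Φ lam := fun ν => Set.Finite.mem_toFinset _
  have hG : ∀ c : E → ℂ, ∑ κ ∈ S, conj (c κ) *
      ∑ μ ∈ S, c μ * torusInner P g (monomial P μ) (monomial P κ) = 0 → ∀ μ ∈ S, c μ = 0 :=
    fun c => eq_zero_of_sum_torusInner_eq_zero hg hΦ fun μ hμ => ((hS μ).mp hμ).1
  have hlamS : lam ∈ S := (hS lam).mpr (mem_dominantBelow_self hlam)
  obtain ⟨c, hc1, hc⟩ := exists_orthogonal_of_gram (G := fun μ κ =>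
    torusInner P g (monomial P μ) (monomial P κ)) hG hlamS
  refine ⟨expansion P Φ lam c, ⟨⟨c, hc1, rfl⟩, fun μ hμ hne => ?_⟩, ?_⟩
  · rw [torusInner_expansion hg hS]
    exact hc μ ((hS μ).mpr hμ) hne
  · rintro _ ⟨⟨b, hb1, rfl⟩, hb⟩
    have h := eq_zero_of_orthogonal (G := fun μ κ =>
      torusInner P g (monomial P μ) (monomial P κ)) hG (a := lam) (b := fun μ => b μ - c μ)
      (by simp [hb1, hc1]) fun κ hκ hne => by
        have hbκ := hb κ ((hS κ).mp hκ) hne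
        rw [torusInner_expansion hg hS] at hbκ
        simp only [sub_mul, Finset.sum_sub_distrib]
        rw [hbκ, hc κ hκ hne, sub_zero]
    funext x
    rw [expansion_eq_sum hS, expansion_eq_sum hS]
    exact Finset.sum_congr rfl fun μ hμ => by rw [sub_eq_zero.mp (h μ hμ)]

/-- The coefficients of a Heckman–Opdam polynomial form an eigenvector of the matrix of the
Laplacian. -/
theorem IsHeckmanOpdam.eigenvector (hΦ : IsPositiveSystem P Φ) (hg : ∀ i, 0 ≤ g i)
    (hgW : ∀ (w : P.weylGroup) (i : ι), g (P.weylGroupToPerm w i) = g i)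
    (hlam : IsDominant P Φ lam) {S : Finset E}
    (hS : ∀ ν, ν ∈ S ↔ ν ∈ dominantBelow P Φ lam) {c : E → ℂ}
    (hp : IsHeckmanOpdam P Φ g lam (expansion P Φ lam c)) {ν : E} (hν : ν ∈ S) :
    ∑ μ ∈ S, c μ * (opMatrix P Φ g μ ν : ℂ) = (eps P Φ g lam : ℂ) * c ν := by
  have hlamS : lam ∈ S := (hS lam).mpr (mem_dominantBelow_self hlam)
  rw [← opMatrix_self hΦ hlam]
  refine eigenvector_of_orthogonal (G := fun μ κ =>
    torusInner P g (monomial P μ) (monomial P κ)) (A := fun μ κ => (opMatrix P Φ g μ κ : ℂ))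
    (fun c => eq_zero_of_sum_torusInner_eq_zero hg hΦ fun μ hμ => ((hS μ).mp hμ).1)
    (fun μ hμ κ hκ => torusInner_opMatrix_symm hg hgW hΦ hS hμ hκ) hlamS
    (fun μ hμ hne => by rw [opMatrix_top hΦ hlam ((hS μ).mp hμ) hne, Complex.ofReal_zero])
    (fun κ hκ hne => ?_) ν hν
  rw [← torusInner_expansion hg hS]
  exact hp.2 κ ((hS κ).mp hκ) hne

/-- The definition only provides some monic expansion; linear independence identifies it with the
given one. -/
theorem IsHeckmanOpdam.coeff_top (hΦ : IsPositiveSystem P Φ) (hlam : IsDominant P Φ lam)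
    {c : E → ℂ} (hp : IsHeckmanOpdam P Φ g lam (expansion P Φ lam c)) : c lam = 1 := by
  set S := (finite_dominantBelow hΦ lam).toFinset
  have hS : ∀ ν, ν ∈ S ↔ ν ∈ dominantBelow P Φ lam := fun ν => Set.Finite.mem_toFinset _
  obtain ⟨b, hb1, hb⟩ := hp.1
  have h := eq_zero_of_sum_mul_monomial_eq_zero hΦ (S := S) (c := fun μ => c μ - b μ)
    (fun μ hμ => ((hS μ).mp hμ).1) (fun x => by
      have hx := congrFun hb x
      rw [expansion_eq_sum hS, expansion_eq_sum hS] at hx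
      simp only [sub_mul, Finset.sum_sub_distrib]
      rw [hx, sub_self]) lam ((hS lam).mpr (mem_dominantBelow_self hlam))
  rw [sub_eq_zero.mp h, hb1]

variable {n : ℕ} {e : Fin (n + 1) → E}

omit [Fintype ι] [P.IsRootSystem] [FiniteDimensional ℝ E] [P.IsCrystallographic]
  [P.IsEuclidean] [MeasurableSpace E] [BorelSpace E] in
theorem IsLinearOrdering.mem (he : IsLinearOrdering P Φ lam e) (j : Fin (n + 1)) :
    e j ∈ dominantBelow P Φ lam :=
  he.range_eq ▸ Set.mem_range_self j

omit [Fintype ι] [P.IsRootSystem] [FiniteDimensional ℝ E] [P.IsCrystallographic]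
  [P.IsEuclidean] [MeasurableSpace E] [BorelSpace E] in
theorem IsLinearOrdering.mem_map_iff (he : IsLinearOrdering P Φ lam e) (ν : E) :
    ν ∈ Finset.univ.map ⟨e, he.injective⟩ ↔ ν ∈ dominantBelow P Φ lam := by
  rw [← he.range_eq]
  simp

omit [FiniteDimensional ℝ E] [P.IsRootSystem] [MeasurableSpace E] [BorelSpace E] in
theorem IsLinearOrdering.dcoef_eq_zero (he : IsLinearOrdering P Φ lam e)
    (hΦ : IsPositiveSystem P Φ) {k l : Fin (n + 1)} (h : ¬ l < k) :
    dcoef P Φ g (e k) (e l) = 0 := by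
  by_contra hd
  obtain ⟨h1, h2⟩ := preceq_and_ne_of_dcoef_ne_zero hΦ (he.mem k).1 hd
  exact h (lt_of_le_of_ne (he.refines l k h1) fun hlk => h2 (congrArg e hlk))

omit [Fintype ι] [P.IsRootSystem] [FiniteDimensional ℝ E] [P.IsCrystallographic]
  [MeasurableSpace E] [BorelSpace E] in
theorem IsLinearOrdering.eps_lt (he : IsLinearOrdering P Φ lam e)
    (hΦ : IsPositiveSystem P Φ) (hg : ∀ i, 0 ≤ g i)
    (hgW : ∀ (w : P.weylGroup) (i : ι), g (P.weylGroupToPerm w i) = g i)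
    {l : Fin (n + 1)} (hl : l ≠ Fin.last n) : eps P Φ g (e l) < eps P Φ g lam :=
  eps_lt_eps hΦ hg hgW (he.mem l).1 (he.mem l).2 fun h =>
    hl (he.injective (h.trans he.last_eq.symm))

omit [Fintype ι] [P.IsRootSystem] [FiniteDimensional ℝ E] [P.IsCrystallographic]
  [P.IsEuclidean] [MeasurableSpace E] [BorelSpace E] in
theorem IsLinearOrdering.normalization_eq (he : IsLinearOrdering P Φ lam e) :
    normalization P Φ g lam = ∏ k : Fin n, (eps P Φ g lam - eps P Φ g (e k.castSucc)) := by
  have hinj : Function.Injective fun k : Fin n => e k.castSucc :=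
    he.injective.comp (Fin.castSucc_injective n)
  have h : dominantBelow P Φ lam \ {lam} = ↑(Finset.univ.map ⟨_, hinj⟩) := by
    rw [← he.range_eq, ← he.last_eq]
    ext ν
    simp only [Set.mem_sdiff, Set.mem_range, Set.mem_singleton_iff, Finset.coe_map,
      Function.Embedding.coeFn_mk, Finset.coe_univ, Set.image_univ]
    constructor
    · rintro ⟨⟨j, rfl⟩, hj⟩
      exact ⟨j.castPred fun h => hj (h ▸ rfl), by simp⟩
    · rintro ⟨k, rfl⟩
      exact ⟨⟨_, rfl⟩, fun h => (Fin.castSucc_lt_last k).ne (he.injective h)⟩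
  rw [normalization, h, finprod_mem_coe_finset, Finset.prod_map]
  rfl

/-- The eigenvalue equation at the weight e l, with the diagonal term moved to the left. The
ordering refines ⪯, so d_{e k, e l} vanishes unless l < k. -/
theorem IsHeckmanOpdam.sub_mul_coeff (hΦ : IsPositiveSystem P Φ) (hg : ∀ i, 0 ≤ g i)
    (hgW : ∀ (w : P.weylGroup) (i : ι), g (P.weylGroupToPerm w i) = g i)
    (hlam : IsDominant P Φ lam) (he : IsLinearOrdering P Φ lam e) {c : E → ℂ}
    (hp : IsHeckmanOpdam P Φ g lam (expansion P Φ lam c)) (l : Fin (n + 1)) :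
    ((eps P Φ g lam - eps P Φ g (e l) : ℝ) : ℂ) * c (e l) =
      ∑ k ∈ Finset.Ioi l, c (e k) * (dcoef P Φ g (e k) (e l) : ℂ) := by
  have h := hp.eigenvector hΦ hg hgW hlam he.mem_map_iff ((he.mem_map_iff (e l)).mpr (he.mem l))
  rw [Finset.sum_map] at h
  simp only [Function.Embedding.coeFn_mk, opMatrix, Complex.ofReal_add, mul_add,
    Finset.sum_add_distrib] at h
  rw [Finset.sum_eq_single_of_mem l (Finset.mem_univ l) fun k _ hk => by
      rw [if_neg fun h => hk (he.injective h), Complex.ofReal_zero, mul_zero],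
    if_pos rfl, ← Finset.sum_subset (Finset.subset_univ (Finset.Ioi l)) fun k _ hk => by
      rw [he.dcoef_eq_zero hΦ (by simpa using hk), Complex.ofReal_zero, mul_zero]] at h
  push_cast
  linear_combination -h

theorem IsHeckmanOpdam.recurrence (hΦ : IsPositiveSystem P Φ) (hg : ∀ i, 0 ≤ g i)
    (hgW : ∀ (w : P.weylGroup) (i : ι), g (P.weylGroupToPerm w i) = g i)
    (hlam : IsDominant P Φ lam) (he : IsLinearOrdering P Φ lam e) {c : E → ℂ}
    (hp : IsHeckmanOpdam P Φ g lam (expansion P Φ lam c)) {l : Fin (n + 1)}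
    (hl : l ≠ Fin.last n) :
    c (e l) = (1 / ((eps P Φ g lam - eps P Φ g (e l) : ℝ) : ℂ)) *
      ∑ k ∈ Finset.Ioi l, c (e k) * (dcoef P Φ g (e k) (e l) : ℂ) := by
  have hne : ((eps P Φ g lam - eps P Φ g (e l) : ℝ) : ℂ) ≠ 0 :=
    Complex.ofReal_ne_zero.mpr (sub_pos.mpr (he.eps_lt hΦ hg hgW hl)).ne'
  rw [← hp.sub_mul_coeff hΦ hg hgW hlam he, one_div, inv_mul_cancel_left₀ hne]

theorem IsHeckmanOpdam.closed_form (hΦ : IsPositiveSystem P Φ) (hg : ∀ i, 0 ≤ g i)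
    (hgW : ∀ (w : P.weylGroup) (i : ι), g (P.weylGroupToPerm w i) = g i)
    (hlam : IsDominant P Φ lam) (he : IsLinearOrdering P Φ lam e) {c : E → ℂ}
    (hp : IsHeckmanOpdam P Φ g lam (expansion P Φ lam c)) {l : Fin (n + 1)}
    (hl : l ≠ Fin.last n) : c (e l) = (chainSum P Φ g lam e l : ℂ) := by
  have h := eq_sum_chainWeight (fun j k => dcoef P Φ g (e j) (e k))
    (fun k => eps P Φ g lam - eps P Φ g (e k)) (c := fun j => c (e j))
    (by rw [he.last_eq, hp.coeff_top hΦ hlam])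
    (fun l hl => hp.recurrence hΦ hg hgW hlam he hl) l
  rw [sum_chainWeight_eq _ _ hl] at h
  exact h

/-- `IsHeckmanOpdam.sub_mul_coeff` says that the row combination with coefficients c(e j) vanishes
in every column but the first, where it is p_lam. The negated superdiagonal entries multiply to the
normalization. -/
theorem IsHeckmanOpdam.eq_det_hessenberg (hΦ : IsPositiveSystem P Φ) (hg : ∀ i, 0 ≤ g i)
    (hgW : ∀ (w : P.weylGroup) (i : ι), g (P.weylGroupToPerm w i) = g i)
    (hlam : IsDominant P Φ lam) (he : IsLinearOrdering P Φ lam e) {c : E → ℂ}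
    (hp : IsHeckmanOpdam P Φ g lam (expansion P Φ lam c)) (x : E) :
    expansion P Φ lam c x =
      (1 / (normalization P Φ g lam : ℂ)) * (hessenberg P Φ g e x).det := by
  have h0 : ∀ j, hessenberg P Φ g e x j 0 = monomial P (e j) x := fun j => rfl
  have hs : ∀ (j : Fin (n + 1)) (k : Fin n), hessenberg P Φ g e x j k.succ =
      if k.castSucc < j then (dcoef P Φ g (e j) (e k.castSucc) : ℂ)
      else if k.castSucc = j then ((eps P Φ g (e j) - eps P Φ g (e (Fin.last n)) : ℝ) : ℂ)
      else 0 := fun j k => rfl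
  have hd := det_hessenberg (hessenberg P Φ g e x)
    (fun j k hjk => by rw [hs, if_neg hjk.le.not_gt, if_neg hjk.ne'])
    (fun j => c (e j)) (by rw [he.last_eq, hp.coeff_top hΦ hlam]) fun k => by
      have hsub := Finset.sum_subset (Finset.subset_univ (Finset.Ici k.castSucc))
        (f := fun j => c (e j) * hessenberg P Φ g e x j k.succ) fun j _ hj => by
          have hj' : j < k.castSucc := by simpa using hj
          rw [hs, if_neg hj'.le.not_gt, if_neg hj'.ne', mul_zero]
      rw [← hsub, ← Finset.add_sum_Ioi_eq_sum_Ici, Finset.sum_congr rfl fun j hj => by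
        rw [hs, if_pos (Finset.mem_Ioi.mp hj)], ← hp.sub_mul_coeff hΦ hg hgW hlam he,
        hs, if_neg (lt_irrefl _), if_pos rfl, he.last_eq]
      push_cast
      ring
  have hprod : ∏ k : Fin n, -hessenberg P Φ g e x k.castSucc k.succ =
      (normalization P Φ g lam : ℂ) := by
    rw [he.normalization_eq, Complex.ofReal_prod]
    refine Finset.prod_congr rfl fun k _ => ?_
    rw [hs, if_neg (lt_irrefl _), if_pos rfl, he.last_eq]
    push_cast
    ring
  have hne : (normalization P Φ g lam : ℂ) ≠ 0 := by
    rw [he.normalization_eq, Complex.ofReal_ne_zero, Finset.prod_ne_zero_iff]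
    exact fun k _ => (sub_pos.mpr (he.eps_lt hΦ hg hgW (Fin.castSucc_lt_last k).ne)).ne'
  rw [hd, hprod, expansion_eq_sum he.mem_map_iff, Finset.sum_map]
  simp only [h0, Function.Embedding.coeFn_mk]
  field_simp

end Main

end HeckmanOpdam

theorem theorem5p5 {ι : Type*} [Fintype ι]
    {E : Type*} [NormedAddCommGroup E] [InnerProductSpace ℝ E] [FiniteDimensional ℝ E]
    [MeasurableSpace E] [BorelSpace E]
    {N : Type*} [AddCommGroup N] [Module ℝ N]
    -- a crystallographic, possibly nonreduced, root system in the Euclidean space `E`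
    (P : RootPairing ι ℝ E N) [P.IsRootSystem] [P.IsCrystallographic] [P.IsEuclidean]
    (Φ : Finset ι) (hΦ : IsPositiveSystem P Φ)
    -- nonnegative parameters, constant on the Weyl orbits of roots
    (g : ι → ℝ) (hg : ∀ i, 0 ≤ g i)
    (hgW : ∀ (w : P.weylGroup) (i : ι), g (P.weylGroupToPerm w i) = g i)
    (lam : E) (hlam : IsDominant P Φ lam) :
    (∃! p : E → ℂ, IsHeckmanOpdam P Φ g lam p) ∧
    ∀ p : E → ℂ, IsHeckmanOpdam P Φ g lam p →
      ∀ (n : ℕ) (e : Fin (n + 1) → E), IsLinearOrdering P Φ lam e →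
        -- the determinantal formula
        (∀ x : E, p x = (1 / (normalization P Φ g lam : ℂ)) * (hessenberg P Φ g e x).det) ∧
        -- the monomial coefficients
        ∀ c : E → ℂ, p = expansion P Φ lam c →
          -- the linear recurrence
          (c (e (Fin.last n)) = 1 ∧
            ∀ l : Fin n,
              c (e l.castSucc) =
                (1 / ((eps P Φ g lam - eps P Φ g (e l.castSucc) : ℝ) : ℂ)) *
                  ∑ k ∈ Finset.Ioi l.castSucc,
                    c (e k) * (dcoef P Φ g (e k) (e l.castSucc) : ℂ)) ∧
          -- the closed form (for the last weight the coefficient is `1`, as stated above)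
          ∀ l : Fin (n + 1), l ≠ Fin.last n →
            c (e l) = (chainSum P Φ g lam e l : ℂ) := by
  refine ⟨existsUnique_isHeckmanOpdam hΦ hg hlam, fun p hp n e he => ⟨fun x => ?_, ?_⟩⟩
  · obtain ⟨c, -, rfl⟩ := hp.1
    exact hp.eq_det_hessenberg hΦ hg hgW hlam he x
  · rintro c rfl
    refine ⟨⟨?_, fun l => ?_⟩, fun l hl => hp.closed_form hΦ hg hgW hlam he hl⟩
    · rw [he.last_eq, hp.coeff_top hΦ hlam]
    · exact hp.recurrence hΦ hg hgW hlam he (Fin.castSucc_lt_last l).ne
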